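/- Let $v:\mathbb R\to\mathbb R$ be a smooth, $1$-periodic, non-constant function. For $d>0$ and $p=(\gamma,\mu)\in\mathbb R^2$ consider the cell problem of the curvature G-equation for the shear flow $V(x)=(v(x_2),0)$, $$-\frac{d\gamma^2 w''}{\gamma^2+(\mu+w')^2}+\sqrt{\gamma^2+(\mu+w')^2}+\gamma v(y)=H\quad\text{in }\mathbb R,\qquad(\ast)$$ where for $\gamma=0$ the first term is understood to be $0$. For every $d>0$ and $p$ there is exactly one number $H=\overline H_d(p)$ for which $(\ast)$ has a $1$-periodic solution $w\in C^2(\mathbb R)$, and for $H=\overline H_d(p)$ there is exactly one such solution with $w(0)=0$; call it $w=w_d$. Moreover, for every $p$ there is exactly one number $H=\overline H_0(p)$ for which the inviscid equation $$\sqrt{\gamma^2+(\mu+w_0')^2}+\gamma v(y)=H\quad\text{in }\mathbb R$$ has a continuous $1$-periodic viscosity solution $w_0$. The following hold. 1. $\overline H_d(0,\pm\mu)=|\mu|$ for all $d>0$ and $\mu\in\mathbb R$. 2. If $\gamma\neq0$, then $d\mapsto\overline H_d(p)$ is differentiable on $(0,\infty)$ with $\dfrac{\partial\overline H_d(p)}{\partial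 d}<0$ for every $d>0$; in particular $\overline H_d(p)$ is strictly decreasing in the Markstein number $d\in(0,\infty)$. 3. For every $p$, $\lim_{d\to0^+}\overline H_d(p)=\overline H_0(p)$. 4. For every $p=(\gamma,\mu)$, $\lim_{d\to+\infty}\overline H_d(p)=|p|+\gamma\int_0^1 v(y)\,dy$, where $|p|=\sqrt{\gamma^2+\mu^2}$, and $\lim_{d\to+\infty}w_d=0$ uniformly on $\mathbb R$. -/

import Mathlib

open Filter Topology
open scoped ContDiff

/-- `w` is a `C²`, `1`-periodic solution on `ℝ` of the cell problem
`-d γ² w'' / (γ² + (μ + w')²) + √(γ² + (μ + w')²) + γ v(y) = H`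
for the shear flow `V(x) = (v(x₂), 0)`, the slope `p = (γ, μ)` and the Markstein number `d`.
(For `γ = 0` the curvature term vanishes identically, also where `μ + w' = 0`.) -/
structure IsCellSolution (v : ℝ → ℝ) (d γ μ H : ℝ) (w : ℝ → ℝ) : Prop where
  contDiff : ContDiff ℝ 2 w
  periodic : Function.Periodic w 1
  equation : ∀ y : ℝ,
    -(d * γ ^ 2 * deriv (deriv w) y / (γ ^ 2 + (μ + deriv w y) ^ 2))
      + √(γ ^ 2 + (μ + deriv w y) ^ 2) + γ * v y = H

/-- The effective flame speed `H̄_d(γ, μ)`: the number for which the cell problem has a `C²`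
periodic solution. -/
noncomputable def effectiveSpeed (v : ℝ → ℝ) (d γ μ : ℝ) : ℝ :=
  Classical.epsilon fun H : ℝ => ∃ w : ℝ → ℝ, IsCellSolution v d γ μ H w

/-- The solution `w` of the cell problem that is normalized by `w(0) = 0`. -/
noncomputable def cellCorrector (v : ℝ → ℝ) (d γ μ : ℝ) : ℝ → ℝ :=
  Classical.epsilon fun w : ℝ → ℝ =>
    IsCellSolution v d γ μ (effectiveSpeed v d γ μ) w ∧ w 0 = 0

/-- `w` is a continuous viscosity subsolution on `ℝ` of `F(y, w') = 0`. -/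
def IsViscositySubsolution (F : ℝ → ℝ → ℝ) (w : ℝ → ℝ) : Prop :=
  Continuous w ∧ ∀ φ : ℝ → ℝ, ContDiff ℝ 1 φ → ∀ y : ℝ,
    IsLocalMax (fun x => w x - φ x) y → F y (deriv φ y) ≤ 0

/-- `w` is a continuous viscosity supersolution on `ℝ` of `F(y, w') = 0`. -/
def IsViscositySupersolution (F : ℝ → ℝ → ℝ) (w : ℝ → ℝ) : Prop :=
  Continuous w ∧ ∀ φ : ℝ → ℝ, ContDiff ℝ 1 φ → ∀ y : ℝ,
    IsLocalMin (fun x => w x - φ x) y → 0 ≤ F y (deriv φ y)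

/-- `w` is a continuous viscosity solution on `ℝ` of `F(y, w') = 0`. -/
def IsViscositySolution (F : ℝ → ℝ → ℝ) (w : ℝ → ℝ) : Prop :=
  IsViscositySubsolution F w ∧ IsViscositySupersolution F w

/-- `w` is a `1`-periodic viscosity solution of the inviscid cell problem
`√(γ² + (μ + w')²) + γ v(y) = H`. -/
def IsInviscidCellSolution (v : ℝ → ℝ) (γ μ H : ℝ) (w : ℝ → ℝ) : Prop :=
  Function.Periodic w 1 ∧
    IsViscositySolution (fun y q => √(γ ^ 2 + (μ + q) ^ 2) + γ * v y - H) w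

/-- The inviscid effective Hamiltonian `H̄_0(γ, μ)`: the number for which the inviscid cell
problem has a periodic viscosity solution. -/
noncomputable def inviscidEffectiveSpeed (v : ℝ → ℝ) (γ μ : ℝ) : ℝ :=
  Classical.epsilon fun H : ℝ => ∃ w : ℝ → ℝ, IsInviscidCellSolution v γ μ H w

open scoped NNReal

/-!
With `r = |γ|`, `u = μ + w'` and `f = γ v`, the curvature term of the cell problem is the exact
derivative of the angle `A(u) = r arctan (u / r)`, so the problem reads
`d (A(u))' = √(r² + u²) + f - H` for a periodic `u` of mean `μ`.

* Existence is a shooting argument for the angle, with the slope truncated: each initial angle has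
  exactly one speed that closes the trajectory, and varying the initial angle produces every mean.
  At the extrema of the angle the equation bounds `u`, which removes the truncation.
* Two slopes of the same mean cross. Comparing their angles where they cross and Gronwall's
  inequality give uniqueness and Lipschitz dependence on `d`.
* A positive periodic solution `ρ` of the adjoint linear equation eliminates the first variation of
  `u` and leaves `H'(d) = ∫ ρ' A(u) / ∫ ρ`. Since `A(u) = r arcsin (u / √(r² + u²))` and integrals
  `∫ g(ρ) ρ'` vanish, monotonicity of `arcsin` makes this negative.
* As `d → ∞` one has `u - μ = O(1 / d)`, and `H` is the mean of `√(r² + u²) + f`.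
* The inviscid equation is `|μ + w'| = √((H - f)² - γ²)`. At the least possible `H` a minimum of
  cones solves it (the Lax–Oleinik formula), and above it `μ + w'` has constant sign. Doubling of
  variables with penalty `c (x - y)²` gives uniqueness. At the doubling points `w'' ≤ 2 c` or
  `w'' ≥ -2 c`, on the side that is needed, so that the viscous and inviscid speeds differ by at
  most `2 c d` plus a small oscillation of `f`.
-/

/-! ### Differential inequalities and periodic functions -/

theorem nonneg_of_hasDerivWithinAt_Ioi {e : ℝ → ℝ} {c x : ℝ}
    (h : HasDerivWithinAt e c (Set.Ioi x) x) (hm : ∀ᶠ z in 𝓝[>] x, e x ≤ e z) : 0 ≤ c := by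
  rw [hasDerivWithinAt_iff_tendsto_slope' (by simp)] at h
  refine ge_of_tendsto h ?_
  filter_upwards [hm, self_mem_nhdsWithin] with z hz hxz
  rw [slope_def_field]
  exact div_nonneg (sub_nonneg.2 hz) (sub_nonneg.2 (Set.mem_Ioi.1 hxz).le)

theorem nonpos_of_hasDerivWithinAt_Iio {e : ℝ → ℝ} {c x : ℝ}
    (h : HasDerivWithinAt e c (Set.Iio x) x) (hm : ∀ᶠ z in 𝓝[<] x, e x ≤ e z) : c ≤ 0 := by
  rw [hasDerivWithinAt_iff_tendsto_slope' (by simp)] at h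
  refine le_of_tendsto h ?_
  filter_upwards [hm, self_mem_nhdsWithin] with z hz hxz
  rw [slope_def_field]
  exact div_nonpos_of_nonneg_of_nonpos (sub_nonneg.2 hz) (sub_nonpos.2 (Set.mem_Iio.1 hxz).le)

theorem pos_of_deriv_pos_of_eq_zero {e e' : ℝ → ℝ} {a b : ℝ} (hab : a < b)
    (hd : ∀ x ∈ Set.Icc a b, HasDerivAt e (e' x) x)
    (h0 : ∀ x ∈ Set.Icc a b, e x = 0 → 0 < e' x) (ha : e a = 0) : 0 < e b := by
  have hnonneg : ∀ ⦃x⦄, x ∈ Set.Icc a b → -e x ≤ 0 := by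
    refine image_le_of_deriv_right_lt_deriv_boundary' (f' := fun x => -e' x) (B' := fun _ => 0)
      ?_ ?_ (by simp [ha]) continuousOn_const (fun x _ => hasDerivWithinAt_const _ _ _) ?_
    · exact fun x hx => (hd x hx).continuousAt.continuousWithinAt.neg
    · exact fun x hx => (hd x ⟨hx.1, hx.2.le⟩).hasDerivWithinAt.neg
    · exact fun x hx h => neg_neg_iff_pos.2 (h0 x ⟨hx.1, hx.2.le⟩ (neg_eq_zero.1 h))
  have hb : b ∈ Set.Icc a b := ⟨hab.le, le_rfl⟩
  refine (neg_nonpos.1 (hnonneg hb)).lt_of_ne' fun h => ?_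
  refine (h0 b hb h).not_ge (nonpos_of_hasDerivWithinAt_Iio (hd b hb).hasDerivWithinAt ?_)
  filter_upwards [Ioo_mem_nhdsLT hab] with z hz
  rw [h]
  exact neg_nonpos.1 (hnonneg ⟨hz.1.le, hz.2.le⟩)

theorem abs_le_of_abs_deriv_le {e e' : ℝ → ℝ} {a b K δ ε : ℝ} (hK : 1 ≤ K) (hε : 0 ≤ ε)
    (hd : ∀ x ∈ Set.Icc a b, HasDerivAt e (e' x) x) (ha : |e a| ≤ δ)
    (hb : ∀ x ∈ Set.Icc a b, |e' x| ≤ K * |e x| + ε) :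
    ∀ x ∈ Set.Icc a b, |e x| ≤ (δ + ε) * Real.exp (K * (b - a)) := by
  intro x hx
  have hδ : 0 ≤ δ := (abs_nonneg _).trans ha
  have hgronwall := norm_le_gronwallBound_of_norm_deriv_right_le
    (fun x hx => (hd x hx).continuousAt.continuousWithinAt)
    (fun x hx => (hd x ⟨hx.1, hx.2.le⟩).hasDerivWithinAt) ha
    (fun x hx => hb x ⟨hx.1, hx.2.le⟩) x hx
  rw [gronwallBound_of_K_ne_0 (by positivity), Real.norm_eq_abs] at hgronwall
  calc |e x| ≤ δ * Real.exp (K * (x - a)) + ε / K * (Real.exp (K * (x - a)) - 1) := hgronwall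
    _ ≤ δ * Real.exp (K * (x - a)) + ε * Real.exp (K * (x - a)) := by
        gcongr
        · exact sub_nonneg.2 (Real.one_le_exp (mul_nonneg (by linarith) (sub_nonneg.2 hx.1)))
        · exact div_le_self hε hK
        · linarith
    _ = (δ + ε) * Real.exp (K * (x - a)) := by ring
    _ ≤ (δ + ε) * Real.exp (K * (b - a)) := by gcongr; exact hx.2

theorem exists_hasDerivAt_of_lipschitzWith_of_norm_le {E : Type*} [NormedAddCommGroup E]
    [NormedSpace ℝ E] [CompleteSpace E] {F : ℝ → E → E} {K C : ℝ≥0}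
    (hlip : ∀ y, LipschitzWith K (F y)) (hcont : ∀ t, Continuous (F · t))
    (hbd : ∀ y t, ‖F y t‖ ≤ C) {y₀ y₁ : ℝ} (hy : y₀ ≤ y₁) (a : E) :
    ∃ u : ℝ → E, u y₀ = a ∧ ∀ y ∈ Set.Icc y₀ y₁, HasDerivAt u (F y (u y)) y := by
  have hpl : IsPicardLindelof F (tmin := y₀ - 1) (tmax := y₁ + 1)
      ⟨y₀, by linarith, by linarith⟩ a (C * (1 + (y₁ - y₀).toNNReal)) 0 C K := by
    refine ⟨fun y _ => (hlip y).lipschitzOnWith, fun t _ => (hcont t).continuousOn,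
      fun y _ t _ => hbd y t, ?_⟩
    simp only [NNReal.coe_mul, NNReal.coe_add, NNReal.coe_one, NNReal.coe_zero, sub_zero,
      Real.coe_toNNReal _ (sub_nonneg.2 hy)]
    gcongr
    exact max_le (by linarith) (by linarith)
  obtain ⟨u, hu0, hu⟩ := hpl.exists_eq_forall_mem_Icc_hasDerivWithinAt₀
  exact ⟨u, hu0, fun y hy => (hu y ⟨by linarith [hy.1], by linarith [hy.2]⟩).hasDerivAt
    (Icc_mem_nhds (by linarith [hy.1]) (by linarith [hy.2]))⟩

theorem periodic_integral_of_integral_eq_zero {q : ℝ → ℝ} {T : ℝ} (hq : Function.Periodic q T)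
    (hi : ∀ a b, IntervalIntegrable q MeasureTheory.volume a b)
    (h0 : ∫ y in (0 : ℝ)..T, q y = 0) (a : ℝ) :
    Function.Periodic (fun y => ∫ x in a..y, q x) T := by
  intro y
  have h := hq.intervalIntegral_add_eq y 0
  rw [zero_add, h0] at h
  simp only [← intervalIntegral.integral_add_adjacent_intervals (hi a y) (hi y (y + T)), h,
    add_zero]

theorem exists_forall_ge_of_periodic {u : ℝ → ℝ} {T : ℝ} (hu : Function.Periodic u T) (hT : T ≠ 0)
    (hc : Continuous u) : ∃ y, ∀ x, u x ≤ u y := by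
  obtain ⟨-, ⟨y, rfl⟩, hy⟩ :=
    (hu.compact_of_continuous hT hc).exists_isGreatest (Set.range_nonempty u)
  exact ⟨y, fun x => hy ⟨x, rfl⟩⟩

theorem exists_forall_le_of_periodic {u : ℝ → ℝ} {T : ℝ} (hu : Function.Periodic u T) (hT : T ≠ 0)
    (hc : Continuous u) : ∃ y, ∀ x, u y ≤ u x := by
  obtain ⟨-, ⟨y, rfl⟩, hy⟩ :=
    (hu.compact_of_continuous hT hc).exists_isLeast (Set.range_nonempty u)
  exact ⟨y, fun x => hy ⟨x, rfl⟩⟩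

theorem exists_abs_le_of_periodic {u : ℝ → ℝ} {T : ℝ} (hu : Function.Periodic u T) (hT : T ≠ 0)
    (hc : Continuous u) : ∃ M, ∀ x, |u x| ≤ M := by
  obtain ⟨y, hy⟩ := exists_forall_ge_of_periodic (u := fun x => |u x|) (fun x => by simp [hu x]) hT
    hc.abs
  exact ⟨|u y|, hy⟩

theorem exists_periodic_extension {F : ℝ → ℝ → ℝ} (hF : Continuous (Function.uncurry F))
    (hper : Function.Periodic F 1) {φ : ℝ → ℝ}
    (hφ : ∀ y ∈ Set.Icc (0 : ℝ) 1, HasDerivAt φ (F y (φ y)) y) (h01 : φ 0 = φ 1) :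
    ∃ u : ℝ → ℝ, Function.Periodic u 1 ∧ (∀ y, HasDerivAt u (F y (u y)) y) ∧
      ∀ y ∈ Set.Icc (0 : ℝ) 1, u y = φ y := by
  have hfract : ∀ y ∈ Set.Icc (0 : ℝ) 1, φ (Int.fract y) = φ y := by
    intro y hy
    rcases hy.2.lt_or_eq with h | h
    · rw [Int.fract_eq_self.2 ⟨hy.1, h⟩]
    · rw [h, Int.fract_one, h01]
  set q : ℝ → ℝ := fun y => F y (φ (Int.fract y)) with hq
  have hqc : Continuous q := hF.comp (continuous_id.prodMk (ContinuousOn.comp_fract''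
    (fun y hy => (hφ y hy).continuousAt.continuousWithinAt) h01))
  have hint : ∀ y ∈ Set.Icc (0 : ℝ) 1, ∫ x in (0 : ℝ)..y, q x = φ y - φ 0 := by
    intro y hy
    refine intervalIntegral.integral_eq_sub_of_hasDerivAt (fun x hx => ?_)
      (hqc.intervalIntegrable _ _)
    rw [Set.uIcc_of_le hy.1] at hx
    have hx' : x ∈ Set.Icc (0 : ℝ) 1 := ⟨hx.1, hx.2.trans hy.2⟩
    simpa only [hq, hfract x hx'] using hφ x hx'
  have hu : Function.Periodic (fun y => φ 0 + ∫ x in (0 : ℝ)..y, q x) 1 := fun y =>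
    congrArg (φ 0 + ·) (periodic_integral_of_integral_eq_zero
      (fun y => by simp only [hq, hper y, Int.fract_add_one])
      (fun a b => hqc.intervalIntegrable _ _) (by rw [hint 1 ⟨zero_le_one, le_rfl⟩, h01, sub_self])
      0 y)
  have hueq : ∀ y ∈ Set.Icc (0 : ℝ) 1, φ 0 + ∫ x in (0 : ℝ)..y, q x = φ y := fun y hy => by
    rw [hint y hy]; ring
  refine ⟨_, hu, fun y => ?_, hueq⟩
  have hy : φ 0 + ∫ x in (0 : ℝ)..y, q x = φ (Int.fract y) := by
    rw [← hueq _ ⟨Int.fract_nonneg y, (Int.fract_lt_one y).le⟩]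
    simpa only [mul_one, Int.fract] using (hu.sub_int_mul_eq (x := y) ⌊y⌋).symm
  simp only [hy]
  exact (hqc.integral_hasStrictDerivAt 0 y).hasDerivAt.const_add _

theorem exists_eq_zero_of_integral_eq_zero {e : ℝ → ℝ} {a b : ℝ} (hab : a < b) (hc : Continuous e)
    (h : ∫ y in a..b, e y = 0) : ∃ y, e y = 0 := by
  have hderiv y := (hc.integral_hasStrictDerivAt a y).hasDerivAt
  obtain ⟨y, -, hy⟩ := exists_hasDerivAt_eq_zero hab
    (fun y _ => (hderiv y).continuousAt.continuousWithinAt) (by simp [h]) (fun y _ => hderiv y)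
  exact ⟨y, hy⟩

theorem exists_eq_of_integral_eq {u u' : ℝ → ℝ} {a b : ℝ} (hab : a < b) (hc : Continuous u)
    (hc' : Continuous u') (h : ∫ y in a..b, u y = ∫ y in a..b, u' y) : ∃ y, u y = u' y := by
  obtain ⟨y, hy⟩ := exists_eq_zero_of_integral_eq_zero hab (e := fun y => u y - u' y)
    (hc.sub hc') (by
    rw [intervalIntegral.integral_sub (hc.intervalIntegrable _ _) (hc'.intervalIntegrable _ _), h,
      sub_self])
  exact ⟨y, sub_eq_zero.1 hy⟩

theorem exists_eq_zero_deriv_nonpos {e e' : ℝ → ℝ} {T : ℝ} (hp : Function.Periodic e T)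
    (hT : 0 < T) (hd : ∀ y, HasDerivAt e (e' y) y) (h0 : ∃ y, e y = 0) :
    ∃ y, e y = 0 ∧ e' y ≤ 0 := by
  obtain ⟨z, hz⟩ := h0
  by_contra! hcon
  have h := pos_of_deriv_pos_of_eq_zero (lt_add_of_pos_right z hT) (fun x _ => hd x)
    (fun x _ => hcon x) hz
  rw [hp z, hz] at h
  exact lt_irrefl _ h

theorem exists_eq_zero_deriv_nonneg {e e' : ℝ → ℝ} {T : ℝ} (hp : Function.Periodic e T)
    (hT : 0 < T) (hd : ∀ y, HasDerivAt e (e' y) y) (h0 : ∃ y, e y = 0) :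
    ∃ y, e y = 0 ∧ 0 ≤ e' y := by
  obtain ⟨y, hy, hderiv⟩ := exists_eq_zero_deriv_nonpos (e := fun y => -e y)
    (fun y => congrArg Neg.neg (hp y)) hT (fun y => (hd y).neg) (by simpa using h0)
  exact ⟨y, neg_eq_zero.1 hy, neg_nonpos.1 hderiv⟩

/-! ### Shooting for periodic trajectories -/

theorem continuous_of_strictAnti_of_eq_zero {α : Type*} [TopologicalSpace α] {N : α → ℝ → ℝ}
    {h : α → ℝ} (hc : ∀ c, Continuous (N · c)) (hanti : ∀ a, StrictAnti (N a))
    (hzero : ∀ a, N a (h a) = 0) : Continuous h := by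
  refine continuous_iff_continuousAt.2 fun a =>
    tendsto_order.2 ⟨fun c hca => ?_, fun c hac => ?_⟩
  · have hpos : 0 < N a c := hzero a ▸ hanti a hca
    filter_upwards [(hc c).continuousAt.eventually (lt_mem_nhds hpos)] with b hb
    exact (hanti b).lt_iff_gt.1 ((hzero b).symm ▸ hb)
  · have hneg : N a c < 0 := hzero a ▸ hanti a hac
    filter_upwards [(hc c).continuousAt.eventually (gt_mem_nhds hneg)] with b hb
    exact (hanti b).lt_iff_gt.1 ((hzero b).symm ▸ hb)

section Shooting

variable {G : ℝ → ℝ → ℝ} {K C : ℝ≥0}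

/-- The trajectories `φ a h` of `θ' = G(y, θ) - h` on `[0, 1]` with `θ(0) = a`, depending
`L`-Lipschitz continuously on the initial value `a` and on the speed `h`. -/
structure IsShootingFlow (G : ℝ → ℝ → ℝ) (φ : ℝ → ℝ → ℝ → ℝ) (L : ℝ) : Prop where
  initial : ∀ a h, φ a h 0 = a
  hasDerivAt : ∀ a h, ∀ y ∈ Set.Icc (0 : ℝ) 1, HasDerivAt (φ a h) (G y (φ a h y) - h) y
  abs_sub_le : ∀ a h a' h', ∀ y ∈ Set.Icc (0 : ℝ) 1,
    |φ a h y - φ a' h' y| ≤ (|a - a'| + |h - h'|) * L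

theorem exists_isShootingFlow (hG : Continuous (Function.uncurry G))
    (hlip : ∀ y, LipschitzWith K (G y)) (hbd : ∀ y t, |G y t| ≤ C) :
    ∃ φ L, IsShootingFlow G φ L := by
  have hex : ∀ a h, ∃ u : ℝ → ℝ, u 0 = a ∧
      ∀ y ∈ Set.Icc (0 : ℝ) 1, HasDerivAt u (G y (u y) - h) y := fun a h =>
    exists_hasDerivAt_of_lipschitzWith_of_norm_le (F := fun y t => G y t - h) (C := C + ‖h‖₊)
      (fun y => by simpa using (hlip y).sub (LipschitzWith.const h))
      (fun t => (hG.comp (Continuous.prodMk_left t)).sub continuous_const)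
      (fun y t => (norm_sub_le _ _).trans (add_le_add_left (hbd y t) _)) zero_le_one a
  choose φ hφ0 hφ using hex
  refine ⟨φ, Real.exp ((K + 1) * (1 - 0)), hφ0, hφ, fun a h a' h' => ?_⟩
  refine abs_le_of_abs_deriv_le (by simp) (abs_nonneg _)
    (fun x hx => (hφ a h x hx).fun_sub (hφ a' h' x hx)) (by rw [hφ0, hφ0]) (fun x _ => ?_)
  calc |G x (φ a h x) - h - (G x (φ a' h' x) - h')|
      = |(G x (φ a h x) - G x (φ a' h' x)) - (h - h')| := by congr 1; ring
    _ ≤ |G x (φ a h x) - G x (φ a' h' x)| + |h - h'| := abs_sub _ _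
    _ ≤ K * |φ a h x - φ a' h' x| + |h - h'| := by
        gcongr; exact (hlip x).dist_le_mul _ _
    _ ≤ (K + 1) * |φ a h x - φ a' h' x| + |h - h'| := by gcongr; linarith

theorem IsShootingFlow.continuous {φ : ℝ → ℝ → ℝ → ℝ} {L y : ℝ} (hφ : IsShootingFlow G φ L)
    (hy : y ∈ Set.Icc (0 : ℝ) 1) : Continuous fun z : ℝ × ℝ => φ z.1 z.2 y := by
  refine (LipschitzWith.of_dist_le' (K := 2 * |L|) fun z z' => ?_).continuous
  calc |φ z.1 z.2 y - φ z'.1 z'.2 y| ≤ (|z.1 - z'.1| + |z.2 - z'.2|) * L :=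
        hφ.abs_sub_le _ _ _ _ y hy
    _ ≤ (|z.1 - z'.1| + |z.2 - z'.2|) * |L| := by gcongr; exact le_abs_self L
    _ ≤ (dist z z' + dist z z') * |L| := by
        gcongr
        exacts [le_max_left (dist z.1 z'.1) _, le_max_right _ (dist z.2 z'.2)]
    _ = 2 * |L| * dist z z' := by ring

theorem IsShootingFlow.exists_closing_speed {φ : ℝ → ℝ → ℝ → ℝ} {L : ℝ}
    (hφ : IsShootingFlow G φ L) (hbd : ∀ y t, |G y t| ≤ C) :
    ∃ h : ℝ → ℝ, Continuous h ∧ ∀ a, |h a| ≤ C ∧ φ a (h a) 0 = φ a (h a) 1 := by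
  have hcont : Continuous fun z : ℝ × ℝ => φ z.1 z.2 1 := hφ.continuous ⟨zero_le_one, le_rfl⟩
  have hanti : ∀ a, StrictAnti fun h => φ a h 1 - a := fun a h h' hh => by
    have hpos := pos_of_deriv_pos_of_eq_zero zero_lt_one
      (fun x hx => (hφ.hasDerivAt a h x hx).fun_sub (hφ.hasDerivAt a h' x hx))
      (fun x _ (hx : φ a h x - φ a h' x = 0) => by rw [sub_eq_zero.1 hx]; linarith)
      (by rw [hφ.initial, hφ.initial, sub_self])
    simpa using hpos
  have hmean : ∀ a h, ∃ s t, φ a h 1 - a = G s t - h := fun a h => by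
    obtain ⟨s, -, hs⟩ := exists_hasDerivAt_eq_slope (φ a h) _ zero_lt_one
      (fun x hx => (hφ.hasDerivAt a h x hx).continuousAt.continuousWithinAt)
      (fun x hx => hφ.hasDerivAt a h x (Set.Ioo_subset_Icc_self hx))
    exact ⟨s, φ a h s, by rw [hs, hφ.initial, sub_zero, div_one]⟩
  have hex : ∀ a, ∃ h ∈ Set.Icc (-(C : ℝ)) C, φ a h 1 - a = 0 := fun a => by
    refine intermediate_value_Icc' (by simp) (f := fun h => φ a h 1 - a)
      ((hcont.comp (Continuous.prodMk_right a)).sub continuous_const).continuousOn ⟨?_, ?_⟩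
    · obtain ⟨s, t, hst⟩ := hmean a C
      linarith [(abs_le.1 (hbd s t)).2]
    · obtain ⟨s, t, hst⟩ := hmean a (-C)
      linarith [(abs_le.1 (hbd s t)).1]
  choose h hC hzero using hex
  refine ⟨h, continuous_of_strictAnti_of_eq_zero (fun c => ?_) hanti hzero, fun a =>
    ⟨abs_le.2 (hC a), by rw [hφ.initial, sub_eq_zero.1 (hzero a)]⟩⟩
  exact (hcont.comp (Continuous.prodMk_left c)).sub continuous_id

theorem exists_continuous_periodic_family (hG : Continuous (Function.uncurry G))
    (hper : Function.Periodic G 1) (hlip : ∀ y, LipschitzWith K (G y))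
    (hbd : ∀ y t, |G y t| ≤ C) :
    ∃ (θ : ℝ → ℝ → ℝ) (h : ℝ → ℝ), Continuous (Function.uncurry θ) ∧ ∀ a,
      Function.Periodic (θ a) 1 ∧ (∀ y, HasDerivAt (θ a) (G y (θ a y) - h a) y) ∧
      ∀ y, |θ a y - a| ≤ 2 * C := by
  obtain ⟨φ, L, hφ⟩ := exists_isShootingFlow hG hlip hbd
  obtain ⟨h, hh, hhφ⟩ := hφ.exists_closing_speed hbd
  have hex : ∀ a, ∃ u : ℝ → ℝ, Function.Periodic u 1 ∧ (∀ y, HasDerivAt u (G y (u y) - h a) y) ∧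
      ∀ y ∈ Set.Icc (0 : ℝ) 1, u y = φ a (h a) y := fun a =>
    exists_periodic_extension (F := fun y t => G y t - h a)
      (hG.sub continuous_const) (fun y => by simp only [hper y])
      (hφ.hasDerivAt a (h a)) (hhφ a).2
  choose θ hθper hθ hθφ using hex
  have hspeed : ∀ a y, |G y (θ a y) - h a| ≤ 2 * C := fun a y =>
    (abs_sub _ _).trans (by linarith [hbd y (θ a y), (hhφ a).1])
  have hθa : ∀ y, Continuous fun a => θ a y := fun y => by
    have hy : Int.fract y ∈ Set.Icc (0 : ℝ) 1 := ⟨Int.fract_nonneg y, (Int.fract_lt_one y).le⟩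
    have hθy : ∀ a, θ a y = φ a (h a) (Int.fract y) := fun a => by
      rw [← hθφ a _ hy, Int.fract, ← mul_one (⌊y⌋ : ℝ), (hθper a).sub_int_mul_eq]
    exact ((hφ.continuous hy).comp (continuous_id.prodMk hh)).congr fun a => (hθy a).symm
  have hlipschitz : ∀ a, LipschitzWith (2 * C) (θ a) := fun a =>
    lipschitzWith_of_nnnorm_deriv_le (fun y => (hθ a y).differentiableAt) fun y => by
      rw [(hθ a y).deriv]; exact hspeed a y
  refine ⟨θ, h, continuous_prod_of_continuous_lipschitzWith' _ (2 * C) hlipschitz hθa,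
    fun a => ⟨hθper a, hθ a, fun y => ?_⟩⟩
  obtain ⟨x, hx, hxy⟩ := (hθper a).exists_mem_Ico₀ one_pos y
  have h0 : θ a 0 = a := by rw [hθφ a 0 ⟨le_rfl, zero_le_one⟩, hφ.initial]
  calc |θ a y - a| = |θ a x - θ a 0| := by rw [hxy, h0]
    _ ≤ 2 * C * |x - 0| := (hlipschitz a).dist_le_mul x 0
    _ ≤ 2 * C * 1 := by
        gcongr
        rw [sub_zero, abs_of_nonneg hx.1]
        exact hx.2.le
    _ = 2 * C := mul_one _

end Shooting

/-! ### The curvature angle -/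

/-- The length `√(r² + t²)` of the vector `(r, t)`, which is the Hamiltonian of the eikonal
equation. -/
noncomputable def eikonal (r t : ℝ) : ℝ := √(r ^ 2 + t ^ 2)

/-- The angle `r arctan (t / r)`, a primitive of `r² / (r² + t²)`, in which the curvature term of
the cell problem becomes an exact derivative. -/
noncomputable def curvAngle (r t : ℝ) : ℝ := r * Real.arctan (t / r)

/-- The slope `r tan (θ / r)` with given angle `θ`, the inverse of `curvAngle`. -/
noncomputable def angleSlope (r θ : ℝ) : ℝ := r * Real.tan (θ / r)

theorem eikonal_eq_norm (r t : ℝ) : eikonal r t = ‖(⟨r, t⟩ : ℂ)‖ := by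
  rw [eikonal, Complex.norm_eq_sqrt_sq_add_sq]

theorem eikonal_sq (r t : ℝ) : eikonal r t ^ 2 = r ^ 2 + t ^ 2 :=
  Real.sq_sqrt (by positivity)

theorem eikonal_nonneg (r t : ℝ) : 0 ≤ eikonal r t := Real.sqrt_nonneg _

theorem abs_le_eikonal (r t : ℝ) : |t| ≤ eikonal r t :=
  Real.abs_le_sqrt (by nlinarith [sq_nonneg r])

theorem abs_left_le_eikonal (r t : ℝ) : |r| ≤ eikonal r t :=
  Real.abs_le_sqrt (by nlinarith [sq_nonneg t])

theorem eikonal_le_eikonal {r s t : ℝ} (h : |s| ≤ |t|) : eikonal r s ≤ eikonal r t :=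
  Real.sqrt_le_sqrt (by linarith [sq_le_sq.2 h])

theorem continuous_eikonal (r : ℝ) : Continuous (eikonal r) := by
  unfold eikonal; fun_prop

theorem continuous_curvAngle (r : ℝ) : Continuous (curvAngle r) := by
  unfold curvAngle; fun_prop

theorem abs_eikonal_sub_le (r s t : ℝ) : |eikonal r s - eikonal r t| ≤ |s - t| := by
  rw [eikonal_eq_norm, eikonal_eq_norm]
  refine (abs_norm_sub_norm_le _ _).trans_eq ?_
  rw [show (⟨r, s⟩ - ⟨r, t⟩ : ℂ) = ((s - t : ℝ) : ℂ) * Complex.I by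
    apply Complex.ext <;> simp, norm_mul, Complex.norm_I, mul_one, Complex.norm_real,
    Real.norm_eq_abs]

section

variable {r : ℝ}

theorem eikonal_pos (hr : 0 < r) (t : ℝ) : 0 < eikonal r t :=
  hr.trans_le ((le_abs_self r).trans (abs_left_le_eikonal r t))

theorem hasDerivAt_eikonal (hr : 0 < r) (t : ℝ) :
    HasDerivAt (eikonal r) (t / eikonal r t) t := by
  have h := ((hasDerivAt_pow 2 t).const_add (r ^ 2)).sqrt (by positivity)
  exact h.congr_deriv (by rw [← eikonal]; ring)

theorem hasDerivAt_curvAngle (hr : 0 < r) (t : ℝ) :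
    HasDerivAt (curvAngle r) (r ^ 2 / eikonal r t ^ 2) t := by
  have h := (((hasDerivAt_id t).div_const r).arctan).const_mul r
  refine h.congr_deriv ?_
  rw [eikonal_sq]
  simp only [id]
  field

theorem strictMono_curvAngle (hr : 0 < r) : StrictMono (curvAngle r) := fun s t h => by
  unfold curvAngle
  gcongr

theorem angleSlope_curvAngle (hr : 0 < r) (t : ℝ) : angleSlope r (curvAngle r t) = t := by
  rw [angleSlope, curvAngle, mul_div_cancel_left₀ _ hr.ne', Real.tan_arctan,
    mul_div_cancel₀ _ hr.ne']

theorem curvAngle_angleSlope (hr : 0 < r) {B θ : ℝ} (hθ : |θ| ≤ curvAngle r B) :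
    curvAngle r (angleSlope r θ) = θ := by
  have hpi : curvAngle r B < r * (Real.pi / 2) := by
    unfold curvAngle
    gcongr
    exact Real.arctan_lt_pi_div_two _
  have h := abs_lt.1 (hθ.trans_lt hpi)
  rw [curvAngle, angleSlope, mul_div_cancel_left₀ _ hr.ne', Real.arctan_tan,
    mul_div_cancel₀ _ hr.ne']
  · rw [lt_div_iff₀ hr]; linarith
  · rw [div_lt_iff₀ hr]; linarith

theorem curvAngle_neg (r t : ℝ) : curvAngle r (-t) = -curvAngle r t := by
  simp only [curvAngle, neg_div, Real.arctan_neg, mul_neg]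

theorem abs_angleSlope_le (hr : 0 < r) {B θ : ℝ} (hθ : |θ| ≤ curvAngle r B) :
    |angleSlope r θ| ≤ B := by
  have h := abs_le.1 hθ
  rw [← curvAngle_neg, ← curvAngle_angleSlope hr hθ] at h
  exact abs_le.2 ⟨(strictMono_curvAngle hr).le_iff_le.1 h.1,
    (strictMono_curvAngle hr).le_iff_le.1 h.2⟩

theorem hasDerivAt_of_hasDerivAt_curvAngle (hr : 0 < r) {u : ℝ → ℝ} {a y : ℝ}
    (h : HasDerivAt (fun y => curvAngle r (u y)) a y) :
    HasDerivAt u (eikonal r (u y) ^ 2 / r ^ 2 * a) y := by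
  have hcos : Real.cos (curvAngle r (u y) / r) ^ 2 = r ^ 2 / eikonal r (u y) ^ 2 := by
    rw [curvAngle, mul_div_cancel_left₀ _ hr.ne', Real.cos_sq_arctan, eikonal_sq]
    field_simp
  have hE := eikonal_pos hr (u y)
  have htan := ((Real.hasDerivAt_tan (pow_ne_zero_iff two_ne_zero |>.1
    (hcos ▸ by positivity))).comp y (h.div_const r)).const_mul r
  refine (htan.congr_deriv ?_).congr_of_eventuallyEq
    (Eventually.of_forall fun x => (angleSlope_curvAngle hr (u x)).symm)
  rw [hcos]
  field_simp

theorem curvAngle_eq_arcsin (hr : 0 < r) (t : ℝ) :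
    curvAngle r t = r * Real.arcsin (t / eikonal r t) := by
  have hsqrt : √(1 + (t / r) ^ 2) = eikonal r t / r := by
    rw [← Real.sqrt_sq (div_nonneg (eikonal_nonneg r t) hr.le), div_pow (eikonal r t),
      eikonal_sq]
    congr 1
    field
  rw [curvAngle, Real.arctan_eq_arcsin, hsqrt]
  field_simp

theorem abs_div_eikonal_lt_one (hr : 0 < r) (t : ℝ) : |t / eikonal r t| < 1 := by
  have hE := eikonal_pos hr t
  rw [abs_div, abs_of_pos hE, div_lt_one hE]
  refine lt_of_pow_lt_pow_left₀ 2 hE.le ?_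
  rw [eikonal_sq, sq_abs]
  exact lt_add_of_pos_left _ (sq_pos_of_pos hr)

theorem curvature_le_one (hr : 0 < r) (t : ℝ) : r ^ 2 / eikonal r t ^ 2 ≤ 1 := by
  rw [eikonal_sq]
  exact div_le_one_of_le₀ (le_add_of_nonneg_right (sq_nonneg t)) (by positivity)

theorem abs_curvAngle_sub_le (hr : 0 < r) (s t : ℝ) :
    |curvAngle r s - curvAngle r t| ≤ |s - t| := by
  have h := convex_univ.norm_image_sub_le_of_norm_hasDerivWithin_le (C := 1)
    (fun x _ => (hasDerivAt_curvAngle hr x).hasDerivWithinAt)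
    (fun x _ => by
      rw [Real.norm_of_nonneg (by positivity)]
      exact curvature_le_one hr x) (Set.mem_univ t) (Set.mem_univ s)
  simpa using h

theorem abs_sub_le_curvAngle_sub (hr : 0 < r) {B s t : ℝ} (hs : |s| ≤ B) (ht : |t| ≤ B) :
    |s - t| ≤ eikonal r B ^ 2 / r ^ 2 * |curvAngle r s - curvAngle r t| := by
  wlog hts : t < s generalizing s t
  · rcases (not_lt.1 hts).eq_or_lt with rfl | h
    · simp
    · rw [abs_sub_comm, abs_sub_comm (curvAngle r s)]
      exact this ht hs h
  obtain ⟨x, hx, hslope⟩ := exists_hasDerivAt_eq_slope (curvAngle r) _ hts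
    (continuous_curvAngle r).continuousOn (fun x _ => hasDerivAt_curvAngle hr x)
  have hxB : |x| ≤ |B| :=
    (abs_le.2 ⟨by linarith [(abs_le.1 ht).1, hx.1], by linarith [(abs_le.1 hs).2, hx.2]⟩).trans
      (le_abs_self B)
  have hA : curvAngle r s - curvAngle r t = r ^ 2 / eikonal r x ^ 2 * (s - t) := by
    rw [hslope, div_mul_cancel₀ _ (sub_pos.2 hts).ne']
  have hE := eikonal_pos hr x
  have hpos := sub_pos.2 hts
  rw [hA, abs_of_pos hpos, abs_of_pos (by positivity)]
  calc s - t = eikonal r x ^ 2 / r ^ 2 * (r ^ 2 / eikonal r x ^ 2 * (s - t)) := by field_simp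
    _ ≤ eikonal r B ^ 2 / r ^ 2 * (r ^ 2 / eikonal r x ^ 2 * (s - t)) := by
        gcongr; exact eikonal_le_eikonal hxB

theorem abs_div_eikonal_sub_le (hr : 0 < r) (s t : ℝ) :
    |s / eikonal r s - t / eikonal r t| ≤ 1 / r * |s - t| := by
  refine convex_univ.norm_image_sub_le_of_norm_hasDerivWithin_le
    (f := fun x => x / eikonal r x) (f' := fun x => r ^ 2 / eikonal r x ^ 3)
    (fun x _ => ?_) (fun x _ => ?_) (Set.mem_univ t) (Set.mem_univ s)
  · have hE := eikonal_pos hr x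
    refine (((hasDerivAt_id x).div (hasDerivAt_eikonal hr x) hE.ne').congr_deriv
      ?_).hasDerivWithinAt
    simp only [id]
    field_simp
    linarith [eikonal_sq r x]
  · have hE := eikonal_pos hr x
    rw [Real.norm_of_nonneg (by positivity)]
    calc r ^ 2 / eikonal r x ^ 3 = r ^ 2 / eikonal r x ^ 2 * (1 / eikonal r x) := by field_simp
      _ ≤ 1 * (1 / r) := by
          gcongr
          exacts [curvature_le_one hr x, (le_abs_self r).trans (abs_left_le_eikonal r x)]
      _ = 1 / r := one_mul _

theorem abs_curvature_sub_le (hr : 0 < r) (s t : ℝ) :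
    |r ^ 2 / eikonal r s ^ 2 - r ^ 2 / eikonal r t ^ 2| ≤ 2 / r * |s - t| := by
  have hcurv : ∀ x, r ^ 2 / eikonal r x ^ 2 = 1 - (x / eikonal r x) ^ 2 := fun x => by
    have hE := eikonal_pos hr x
    field_simp
    linarith [eikonal_sq r x]
  have hsum : |t / eikonal r t + s / eikonal r s| ≤ 2 :=
    (abs_add_le _ _).trans (by linarith [abs_div_eikonal_lt_one hr s, abs_div_eikonal_lt_one hr t])
  calc |r ^ 2 / eikonal r s ^ 2 - r ^ 2 / eikonal r t ^ 2|
      = |t / eikonal r t + s / eikonal r s| * |s / eikonal r s - t / eikonal r t| := by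
        rw [hcurv, hcurv, abs_sub_comm (s / _), ← abs_mul]; congr 1; ring
    _ ≤ 2 * (1 / r * |s - t|) := by
        gcongr; exact abs_div_eikonal_sub_le hr s t
    _ = 2 / r * |s - t| := by ring

end

theorem abs_sub_sub_deriv_mul_le {F F' : ℝ → ℝ} {K : ℝ} (hK : 0 ≤ K)
    (hF : ∀ x, HasDerivAt F (F' x) x) (hF' : ∀ s t, |F' s - F' t| ≤ K * |s - t|) (s t : ℝ) :
    |F s - F t - F' t * (s - t)| ≤ K * (s - t) ^ 2 := by
  have hd : ∀ x ∈ Set.uIcc t s,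
      HasDerivWithinAt (fun x => F x - F' t * x) (F' x - F' t) (Set.uIcc t s) x := fun x _ =>
    ((hF x).sub (((hasDerivAt_id x).const_mul (F' t)).congr_deriv (mul_one _))).hasDerivWithinAt
  have hbound : ∀ x ∈ Set.uIcc t s, ‖F' x - F' t‖ ≤ K * |s - t| := fun x hx =>
    (hF' x t).trans (mul_le_mul_of_nonneg_left (Set.abs_sub_left_of_mem_uIcc hx) hK)
  calc |F s - F t - F' t * (s - t)| = |F s - F' t * s - (F t - F' t * t)| := by congr 1; ring
    _ ≤ K * |s - t| * |s - t| := (convex_uIcc t s).norm_image_sub_le_of_norm_hasDerivWithin_le hd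
        hbound Set.left_mem_uIcc Set.right_mem_uIcc
    _ = K * (s - t) ^ 2 := by rw [← sq_abs (s - t)]; ring

/-! ### A priori bounds and uniqueness -/

/-- `u` is a periodic solution with mean `μ` of `d (A ∘ u)' = √(r² + u²) + f - H`, where `A` is
`curvAngle r`. With `r = |γ|` and `f = γ v` this is the equation for the slope `u = μ + w'` of a
solution `w` of the cell problem. -/
structure IsSlope (f : ℝ → ℝ) (d r μ H : ℝ) (u : ℝ → ℝ) : Prop where
  periodic : Function.Periodic u 1
  hasDerivAt_curvAngle : ∀ y,
    HasDerivAt (fun y => curvAngle r (u y)) ((eikonal r (u y) + f y - H) / d) y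
  mean : ∫ y in (0 : ℝ)..1, u y = μ

section Phase

variable {f θ u : ℝ → ℝ} {d r H M μ α : ℝ}

theorem abs_speed_sub_eikonal_le_of_phase (hd : 0 < d) (hM : ∀ y, |f y| ≤ M)
    (hθ : Function.Periodic θ 1)
    (hθ' : ∀ y, HasDerivAt θ ((eikonal r (u y) + f y - H) / d) y) (hα : ∃ y, θ y = α)
    (hαμ : ∀ y, θ y = α → u y = μ) : |H - eikonal r μ| ≤ M := by
  have hper : Function.Periodic (fun y => θ y - α) 1 := fun y => congrArg (· - α) (hθ y)
  have hzero : ∃ y, θ y - α = 0 := by simpa only [sub_eq_zero] using hα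
  obtain ⟨y, hy, hy'⟩ :=
    exists_eq_zero_deriv_nonpos hper one_pos (fun y => (hθ' y).sub_const α) hzero
  obtain ⟨x, hx, hx'⟩ :=
    exists_eq_zero_deriv_nonneg hper one_pos (fun y => (hθ' y).sub_const α) hzero
  rw [hαμ y (sub_eq_zero.1 hy), div_le_iff₀ hd, zero_mul] at hy'
  rw [hαμ x (sub_eq_zero.1 hx), le_div_iff₀ hd, zero_mul] at hx'
  exact abs_le.2 ⟨by linarith [(abs_le.1 (hM y)).1], by linarith [(abs_le.1 (hM x)).2]⟩

theorem eikonal_le_of_phase (hd : 0 < d) (hM : ∀ y, |f y| ≤ M) (hθ : Function.Periodic θ 1)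
    (hθ' : ∀ y, HasDerivAt θ ((eikonal r (u y) + f y - H) / d) y) (hα : ∃ y, θ y = α)
    (hαμ : ∀ y, θ y = α → u y = μ) (hmono : ∀ x y, θ x ≤ θ y → u x ≤ u y) (y : ℝ) :
    eikonal r (u y) ≤ eikonal r μ + 2 * M := by
  have hH := (abs_le.1 (abs_speed_sub_eikonal_le_of_phase hd hM hθ hθ' hα hαμ)).2
  have hθc : Continuous θ := continuous_iff_continuousAt.2 fun y => (hθ' y).continuousAt
  obtain ⟨a, ha⟩ := exists_forall_ge_of_periodic hθ one_ne_zero hθc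
  obtain ⟨b, hb⟩ := exists_forall_le_of_periodic hθ one_ne_zero hθc
  -- By monotonicity `u` is extremal where `θ` is, and there `√(r² + u²) = H - f`.
  have hEa := IsLocalMax.hasDerivAt_eq_zero (Eventually.of_forall ha) (hθ' a)
  have hEb := IsLocalMin.hasDerivAt_eq_zero (Eventually.of_forall hb) (hθ' b)
  rw [div_eq_zero_iff, or_iff_left hd.ne'] at hEa hEb
  rcases le_max_iff.1 (abs_le_max_abs_abs (hmono b y (hb y)) (hmono y a (ha y))) with h | h
  · linarith [eikonal_le_eikonal (r := r) h, (abs_le.1 (hM b)).1]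
  · linarith [eikonal_le_eikonal (r := r) h, (abs_le.1 (hM a)).1]

end Phase

namespace IsSlope

variable {f u u' : ℝ → ℝ} {d d' r μ H H' M Q : ℝ}

theorem hasDerivAt (h : IsSlope f d r μ H u) (hr : 0 < r) (y : ℝ) :
    HasDerivAt u (eikonal r (u y) ^ 2 / r ^ 2 * ((eikonal r (u y) + f y - H) / d)) y :=
  hasDerivAt_of_hasDerivAt_curvAngle hr (h.hasDerivAt_curvAngle y)

theorem continuous (h : IsSlope f d r μ H u) (hr : 0 < r) : Continuous u :=
  continuous_iff_continuousAt.2 fun y => (h.hasDerivAt hr y).continuousAt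

theorem exists_eq_mean (h : IsSlope f d r μ H u) (hr : 0 < r) : ∃ y, u y = μ :=
  exists_eq_of_integral_eq one_pos (h.continuous hr) continuous_const (by simp [h.mean])

theorem curvAngle_periodic (h : IsSlope f d r μ H u) :
    Function.Periodic (fun y => curvAngle r (u y)) 1 := fun y =>
  congrArg (curvAngle r) (h.periodic y)

theorem abs_speed_sub_le (h : IsSlope f d r μ H u) (hd : 0 < d) (hr : 0 < r)
    (hM : ∀ y, |f y| ≤ M) : |H - eikonal r μ| ≤ M :=
  abs_speed_sub_eikonal_le_of_phase hd hM h.curvAngle_periodic h.hasDerivAt_curvAngle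
    ((h.exists_eq_mean hr).imp fun _ hy => congrArg (curvAngle r) hy)
    fun _ hy => (strictMono_curvAngle hr).injective hy

theorem eikonal_le (h : IsSlope f d r μ H u) (hd : 0 < d) (hr : 0 < r)
    (hM : ∀ y, |f y| ≤ M) (y : ℝ) : eikonal r (u y) ≤ eikonal r μ + 2 * M :=
  eikonal_le_of_phase hd hM h.curvAngle_periodic h.hasDerivAt_curvAngle
    ((h.exists_eq_mean hr).imp fun _ hy => congrArg (curvAngle r) hy)
    (fun _ hy => (strictMono_curvAngle hr).injective hy)
    (fun _ _ hxy => (strictMono_curvAngle hr).le_iff_le.1 hxy) y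

theorem abs_residual_le (h : IsSlope f d r μ H u) (hd : 0 < d) (hr : 0 < r)
    (hM : ∀ y, |f y| ≤ M) (y : ℝ) :
    |eikonal r (u y) + f y - H| ≤ eikonal r μ + 4 * M := by
  have hH := abs_le.1 (h.abs_speed_sub_le hd hr hM)
  have hf := abs_le.1 (hM y)
  exact abs_le.2 ⟨by linarith [eikonal_nonneg r (u y), abs_nonneg (f y), hM y],
    by linarith [h.eikonal_le hd hr hM y, eikonal_nonneg r μ]⟩

theorem exists_eq (h : IsSlope f d r μ H u) (h' : IsSlope f d' r μ H' u') (hr : 0 < r) :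
    ∃ y, u y = u' y :=
  exists_eq_of_integral_eq one_pos (h.continuous hr) (h'.continuous hr)
    (h.mean.trans h'.mean.symm)

theorem abs_speed_sub_speed_le (h : IsSlope f d r μ H u) (h' : IsSlope f d' r μ H' u')
    (hd : 0 < d) (hd' : 0 < d') (hr : 0 < r) (hQ : ∀ y, |eikonal r (u y) + f y - H| ≤ Q) :
    |H' - H| ≤ Q / d * |d' - d| := by
  have hper := h'.curvAngle_periodic.sub h.curvAngle_periodic
  have hderiv := fun y => (h'.hasDerivAt_curvAngle y).sub (h.hasDerivAt_curvAngle y)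
  have hzero := (h'.exists_eq h hr).imp fun _ hy => sub_eq_zero.2 (congrArg (curvAngle r) hy)
  have hslope : ∀ {y}, curvAngle r (u' y) - curvAngle r (u y) = 0 → u' y = u y := fun hy =>
    (strictMono_curvAngle hr).injective (sub_eq_zero.1 hy)
  have hresidual : ∀ y, |(eikonal r (u y) + f y - H) * (d' - d) / d| ≤ Q / d * |d' - d| := by
    intro y
    rw [abs_div, abs_mul, abs_of_pos hd, div_mul_eq_mul_div]
    gcongr
    exact hQ y
  obtain ⟨y, hy, hy'⟩ := exists_eq_zero_deriv_nonpos hper one_pos hderiv hzero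
  obtain ⟨x, hx, hx'⟩ := exists_eq_zero_deriv_nonneg hper one_pos hderiv hzero
  rw [hslope hy, sub_nonpos, div_le_div_iff₀ hd' hd] at hy'
  rw [hslope hx, sub_nonneg, div_le_div_iff₀ hd hd'] at hx'
  have hlow : -((eikonal r (u y) + f y - H) * (d' - d) / d) ≤ H' - H := by
    rw [← neg_div, div_le_iff₀ hd]; linarith
  have hupp : H' - H ≤ -((eikonal r (u x) + f x - H) * (d' - d) / d) := by
    rw [← neg_div, le_div_iff₀ hd]; linarith
  exact abs_le.2 ⟨by linarith [(abs_le.1 (hresidual y)).2],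
    by linarith [(abs_le.1 (hresidual x)).1]⟩

theorem abs_deriv_curvAngle_sub_le (h : IsSlope f d r μ H u) (h' : IsSlope f d' r μ H' u')
    (hd : 0 < d) (hdd' : d / 2 ≤ d') (hr : 0 < r)
    (hQ : ∀ y, |eikonal r (u y) + f y - H| ≤ Q) (y : ℝ) :
    |(eikonal r (u' y) + f y - H') / d' - (eikonal r (u y) + f y - H) / d|
      ≤ 2 / d * |u' y - u y| + 4 * Q / d ^ 2 * |d' - d| := by
  have hd' : 0 < d' := (half_pos hd).trans_le hdd'
  have hH := h.abs_speed_sub_speed_le h' hd hd' hr hQ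
  have hinv : 1 / d' ≤ 2 / d := by
    rw [div_le_div_iff₀ hd' hd]; linarith
  set R := eikonal r (u y) + f y - H with hR
  have hRd : |R * (d' - d) / d| ≤ Q / d * |d' - d| := by
    rw [abs_div, abs_mul, abs_of_pos hd, div_mul_eq_mul_div]
    gcongr
    exact hQ y
  calc |(eikonal r (u' y) + f y - H') / d' - R / d|
      = |1 / d'| * |(eikonal r (u' y) - eikonal r (u y)) - (H' - H) - R * (d' - d) / d| := by
        rw [← abs_mul, hR]
        congr 1
        field
    _ ≤ 2 / d * (|u' y - u y| + Q / d * |d' - d| + Q / d * |d' - d|) := by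
        rw [abs_of_pos (one_div_pos.2 hd')]
        gcongr
        refine (abs_sub _ _).trans (add_le_add ((abs_sub _ _).trans (add_le_add ?_ hH)) hRd)
        exact abs_eikonal_sub_le r _ _
    _ = 2 / d * |u' y - u y| + 4 * Q / d ^ 2 * |d' - d| := by field

theorem exists_abs_sub_le (h : IsSlope f d r μ H u) (hd : 0 < d) (hr : 0 < r)
    (hM : ∀ y, |f y| ≤ M) :
    ∃ C, 0 ≤ C ∧ ∀ d' H' u', d / 2 ≤ d' → IsSlope f d' r μ H' u' →
      ∀ y, |u' y - u y| ≤ C * |d' - d| := by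
  set Q := eikonal r μ + 4 * M
  have hQ : ∀ y, |eikonal r (u y) + f y - H| ≤ Q := h.abs_residual_le hd hr hM
  have hQ0 : 0 ≤ Q := (abs_nonneg _).trans (hQ 0)
  set L := eikonal r (eikonal r μ + 2 * M) ^ 2 / r ^ 2
  set K := 2 / d * L + 1
  refine ⟨L * (4 * Q / d ^ 2 * Real.exp K), by positivity, fun d' H' u' hdd' h' y => ?_⟩
  have hd' : 0 < d' := (half_pos hd).trans_le hdd'
  have hangle : ∀ x, |u' x - u x| ≤ L * |curvAngle r (u' x) - curvAngle r (u x)| := fun x =>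
    abs_sub_le_curvAngle_sub hr ((abs_le_eikonal r _).trans (h'.eikonal_le hd' hr hM x))
      ((abs_le_eikonal r _).trans (h.eikonal_le hd hr hM x))
  have hgrowth : ∀ x, |(eikonal r (u' x) + f x - H') / d' - (eikonal r (u x) + f x - H) / d|
      ≤ K * |curvAngle r (u' x) - curvAngle r (u x)| + 4 * Q / d ^ 2 * |d' - d| := fun x => by
    have h1 := h.abs_deriv_curvAngle_sub_le h' hd hdd' hr hQ x
    have h2 := mul_le_mul_of_nonneg_left (hangle x) (by positivity : 0 ≤ 2 / d)
    linarith [abs_nonneg (curvAngle r (u' x) - curvAngle r (u x))]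
  obtain ⟨z, hz⟩ := h'.exists_eq h hr
  obtain ⟨x, hx, hxy⟩ :=
    (h'.curvAngle_periodic.sub h.curvAngle_periodic).exists_mem_Ico one_pos y z
  have hgronwall := abs_le_of_abs_deriv_le (le_add_of_nonneg_left (by positivity)) (by positivity)
    (fun x _ => (h'.hasDerivAt_curvAngle x).fun_sub (h.hasDerivAt_curvAngle x))
    (by rw [hz, sub_self, abs_zero]) (fun x _ => hgrowth x) x ⟨hx.1, hx.2.le⟩
  simp only [Pi.sub_apply] at hxy
  calc |u' y - u y| ≤ L * |curvAngle r (u' x) - curvAngle r (u x)| := hxy ▸ hangle y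
    _ ≤ L * ((0 + 4 * Q / d ^ 2 * |d' - d|) * Real.exp (K * (z + 1 - z))) := by gcongr
    _ = L * (4 * Q / d ^ 2 * Real.exp K) * |d' - d| := by
        rw [add_sub_cancel_left, mul_one]; ring

theorem unique (h : IsSlope f d r μ H u) (h' : IsSlope f d r μ H' u') (hd : 0 < d)
    (hr : 0 < r) (hM : ∀ y, |f y| ≤ M) : H = H' ∧ u = u' := by
  obtain ⟨C, -, hC⟩ := h.exists_abs_sub_le hd hr hM
  have hu : ∀ y, |u' y - u y| ≤ 0 := by simpa using fun y => hC d H' u' (half_le_self hd.le) h' y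
  have hH : |H' - H| ≤ 0 := by
    simpa using h.abs_speed_sub_speed_le h' hd hd hr (h.abs_residual_le hd hr hM)
  exact ⟨(sub_eq_zero.1 (abs_nonpos_iff.1 hH)).symm,
    funext fun y => (sub_eq_zero.1 (abs_nonpos_iff.1 (hu y))).symm⟩

end IsSlope

/-- The slope with angle `θ`, truncated to `[-B, B]`. -/
noncomputable def truncSlope (r B θ : ℝ) : ℝ :=
  angleSlope r (max (-curvAngle r B) (min θ (curvAngle r B)))

section Truncation

variable {r B θ t : ℝ}

theorem curvAngle_nonneg (hr : 0 < r) (ht : 0 ≤ t) : 0 ≤ curvAngle r t := by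
  simpa [curvAngle] using (strictMono_curvAngle hr).monotone ht

theorem abs_clamp_le (hr : 0 < r) (hB : 0 ≤ B) (θ : ℝ) :
    |max (-curvAngle r B) (min θ (curvAngle r B))| ≤ curvAngle r B :=
  abs_le.2 ⟨le_max_left _ _,
    max_le (neg_le_self (curvAngle_nonneg hr hB)) (min_le_right _ _)⟩

theorem curvAngle_truncSlope (hr : 0 < r) (hB : 0 ≤ B) (θ : ℝ) :
    curvAngle r (truncSlope r B θ) = max (-curvAngle r B) (min θ (curvAngle r B)) :=
  curvAngle_angleSlope hr (abs_clamp_le hr hB θ)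

theorem abs_truncSlope_le (hr : 0 < r) (hB : 0 ≤ B) (θ : ℝ) : |truncSlope r B θ| ≤ B :=
  abs_angleSlope_le hr (abs_clamp_le hr hB θ)

theorem truncSlope_of_curvAngle_le (hr : 0 < r) (hB : 0 ≤ B) (h : curvAngle r B ≤ θ) :
    truncSlope r B θ = B := by
  rw [truncSlope, min_eq_right h, max_eq_right (neg_le_self (curvAngle_nonneg hr hB)),
    angleSlope_curvAngle hr]

theorem truncSlope_of_le_neg_curvAngle (hr : 0 < r) (h : θ ≤ -curvAngle r B) :
    truncSlope r B θ = -B := by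
  rw [truncSlope, max_eq_left ((min_le_left _ _).trans h), ← curvAngle_neg,
    angleSlope_curvAngle hr]

theorem truncSlope_curvAngle (hr : 0 < r) (ht : |t| ≤ B) : truncSlope r B (curvAngle r t) = t := by
  have hmono := (strictMono_curvAngle hr).monotone
  rw [truncSlope, min_eq_left (hmono (abs_le.1 ht).2), ← curvAngle_neg,
    max_eq_right (hmono (abs_le.1 ht).1), angleSlope_curvAngle hr]

theorem curvAngle_truncSlope_of_abs_lt (hr : 0 < r) (hB : 0 ≤ B) (h : |truncSlope r B θ| < B) :
    curvAngle r (truncSlope r B θ) = θ := by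
  have hlow : -curvAngle r B < θ := by
    by_contra! hle
    rw [truncSlope_of_le_neg_curvAngle hr hle, abs_neg, abs_of_nonneg hB] at h
    exact h.false
  have hupp : θ < curvAngle r B := by
    by_contra! hle
    rw [truncSlope_of_curvAngle_le hr hB hle, abs_of_nonneg hB] at h
    exact h.false
  rw [curvAngle_truncSlope hr hB, min_eq_left hupp.le, max_eq_right hlow.le]

theorem monotone_truncSlope (hr : 0 < r) (hB : 0 ≤ B) : Monotone (truncSlope r B) :=
  fun θ θ' h => (strictMono_curvAngle hr).le_iff_le.1 (by
    rw [curvAngle_truncSlope hr hB, curvAngle_truncSlope hr hB]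
    exact max_le_max_left _ (min_le_min_right _ h))

theorem lipschitzWith_truncSlope (hr : 0 < r) (hB : 0 ≤ B) :
    LipschitzWith (eikonal r B ^ 2 / r ^ 2).toNNReal (truncSlope r B) := by
  have hclamp : LipschitzWith 1 fun θ => max (-curvAngle r B) (min θ (curvAngle r B)) :=
    (LipschitzWith.id.min_const _).const_max _
  refine LipschitzWith.of_dist_le_mul fun θ θ' => ?_
  have h := abs_sub_le_curvAngle_sub hr (abs_truncSlope_le hr hB θ) (abs_truncSlope_le hr hB θ')
  rw [curvAngle_truncSlope hr hB, curvAngle_truncSlope hr hB] at h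
  rw [Real.coe_toNNReal _ (by positivity)]
  refine h.trans (mul_le_mul_of_nonneg_left ?_ (by positivity))
  simpa [Real.dist_eq] using hclamp.dist_le_mul θ θ'

end Truncation

section Existence

variable {f : ℝ → ℝ} {d r B μ : ℝ}

theorem exists_mean_truncSlope_eq {θ : ℝ → ℝ → ℝ} {C : ℝ} (hr : 0 < r)
    (hθ : Continuous (Function.uncurry θ)) (hC : ∀ a y, |θ a y - a| ≤ C) (hμ : |μ| ≤ B) :
    ∃ a, ∫ y in (0 : ℝ)..1, truncSlope r B (θ a y) = μ := by
  have hB : 0 ≤ B := (abs_nonneg μ).trans hμ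
  have hcont : Continuous fun a => ∫ y in (0 : ℝ)..1, truncSlope r B (θ a y) :=
    intervalIntegral.continuous_parametric_intervalIntegral_of_continuous'
      (f := fun a y => truncSlope r B (θ a y))
      ((lipschitzWith_truncSlope hr hB).continuous.comp hθ) 0 1
  refine mem_range_of_exists_le_of_exists_ge hcont ⟨-curvAngle r B - C, ?_⟩ ⟨curvAngle r B + C, ?_⟩
  · have hlow : ∀ y, truncSlope r B (θ (-curvAngle r B - C) y) = -B := fun y =>
      truncSlope_of_le_neg_curvAngle hr (by linarith [(abs_le.1 (hC (-curvAngle r B - C) y)).2])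
    simpa [hlow] using (abs_le.1 hμ).1
  · have hupp : ∀ y, truncSlope r B (θ (curvAngle r B + C) y) = B := fun y =>
      truncSlope_of_curvAngle_le hr hB
        (by linarith [(abs_le.1 (hC (curvAngle r B + C) y)).1])
    simpa [hupp] using (abs_le.1 hμ).2

theorem exists_truncated_phase (hd : 0 < d) (hr : 0 < r) (hf : Continuous f)
    (hper : Function.Periodic f 1) (hμ : |μ| ≤ B) :
    ∃ (H : ℝ) (θ : ℝ → ℝ), Function.Periodic θ 1 ∧
      (∀ y, HasDerivAt θ ((eikonal r (truncSlope r B (θ y)) + f y - H) / d) y) ∧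
      ∫ y in (0 : ℝ)..1, truncSlope r B (θ y) = μ := by
  have hB : 0 ≤ B := (abs_nonneg μ).trans hμ
  obtain ⟨M, hM⟩ := exists_abs_le_of_periodic hper one_ne_zero hf
  have hlipτ := lipschitzWith_truncSlope hr hB
  have hE : ∀ θ, eikonal r (truncSlope r B θ) ≤ eikonal r B := fun θ =>
    eikonal_le_eikonal ((abs_truncSlope_le hr hB θ).trans (le_abs_self B))
  have hlipE : LipschitzWith 1 (eikonal r) := LipschitzWith.of_dist_le_mul fun s t => by
    simpa [Real.dist_eq] using abs_eikonal_sub_le r s t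
  obtain ⟨θ, h, hθc, hθ⟩ := exists_continuous_periodic_family
    (G := fun y t => (eikonal r (truncSlope r B t) + f y) / d)
    (K := (1 / d).toNNReal * (eikonal r B ^ 2 / r ^ 2).toNNReal)
    (C := ((eikonal r B + M) / d).toNNReal)
    ((((continuous_eikonal r).comp (hlipτ.continuous.comp continuous_snd)).add
      (hf.comp continuous_fst)).div_const d)
    (fun y => by simp only [hper y])
    (fun y => LipschitzWith.of_dist_le_mul fun s t => by
      have hcomp := (hlipE.comp hlipτ).dist_le_mul s t
      rw [one_mul] at hcomp
      rw [NNReal.coe_mul, Real.coe_toNNReal (1 / d) (by positivity), Real.dist_eq, ← sub_div,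
        add_sub_add_right_eq_sub, abs_div, abs_of_pos hd, div_eq_inv_mul, ← one_div, mul_assoc]
      exact mul_le_mul_of_nonneg_left hcomp (by positivity))
    (fun y t => by
      refine le_trans ?_ (Real.le_coe_toNNReal _)
      rw [abs_div, abs_of_pos hd]
      gcongr
      refine (abs_add_le _ _).trans (add_le_add ?_ (hM y))
      exact (abs_of_nonneg (eikonal_nonneg r _)).trans_le (hE t))
  obtain ⟨a, ha⟩ := exists_mean_truncSlope_eq hr hθc (fun a => (hθ a).2.2) hμ
  refine ⟨d * h a, θ a, (hθ a).1, fun y => ((hθ a).2.1 y).congr_deriv ?_, ha⟩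
  rw [sub_div, mul_div_cancel_left₀ _ hd.ne']

theorem exists_isSlope (hd : 0 < d) (hr : 0 < r) (hf : Continuous f)
    (hper : Function.Periodic f 1) (μ : ℝ) : ∃ H u, IsSlope f d r μ H u := by
  obtain ⟨M, hM⟩ := exists_abs_le_of_periodic hper one_ne_zero hf
  have hM0 : 0 ≤ M := (abs_nonneg _).trans (hM 0)
  set B := eikonal r μ + 2 * M + 1
  have hμB : |μ| < B := by linarith [abs_le_eikonal r μ]
  have hB : 0 ≤ B := (abs_nonneg μ).trans hμB.le
  obtain ⟨H, θ, hθ, hθ', hmean⟩ := exists_truncated_phase hd hr hf hper hμB.le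
  have hθc : Continuous θ := continuous_iff_continuousAt.2 fun y => (hθ' y).continuousAt
  have hα : ∃ y, θ y = curvAngle r μ := by
    obtain ⟨y, hy⟩ : ∃ y, truncSlope r B (θ y) = μ := exists_eq_of_integral_eq one_pos
      ((lipschitzWith_truncSlope hr hB).continuous.comp hθc) continuous_const
      (hmean.trans (by simp))
    exact ⟨y, hy ▸ (curvAngle_truncSlope_of_abs_lt hr hB (hy ▸ hμB)).symm⟩
  have hbound := eikonal_le_of_phase hd hM hθ hθ' hα
    (fun y hy => by rw [hy, truncSlope_curvAngle hr hμB.le])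
    (fun x y hxy => monotone_truncSlope hr hB hxy)
  have hinv : ∀ y, curvAngle r (truncSlope r B (θ y)) = θ y := fun y =>
    curvAngle_truncSlope_of_abs_lt hr hB ((abs_le_eikonal r _).trans_lt (by linarith [hbound y]))
  refine ⟨H, fun y => truncSlope r B (θ y), fun y => congrArg _ (hθ y), fun y => ?_, hmean⟩
  simpa only [hinv] using hθ' y

end Existence

/-! ### The adjoint weight and differentiability of the speed -/

theorem hasDerivAt_of_abs_sub_le_sq {g : ℝ → ℝ} {a c K : ℝ}
    (h : ∀ᶠ x in 𝓝 a, |g x - g a - (x - a) * c| ≤ K * (x - a) ^ 2) : HasDerivAt g c a := by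
  rw [hasDerivAt_iff_isLittleO]
  have hbigO : (fun x => g x - g a - (x - a) • c) =O[𝓝 a] fun x => (x - a) ^ 2 :=
    Asymptotics.IsBigO.of_bound K (by simpa using h)
  refine hbigO.trans_isLittleO ?_
  exact (Asymptotics.isLittleO_pow_id one_lt_two (𝕜 := ℝ)).comp_tendsto
    (tendsto_sub_nhds_zero_iff.2 tendsto_id : Tendsto (fun x => x - a) (𝓝 a) (𝓝 0))

theorem exists_positive_periodic_linear {β κ : ℝ → ℝ} (hβ : Continuous β) (hκ : Continuous κ)
    (hpos : ∀ y, 0 < κ y) :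
    ∃ (ρ : ℝ → ℝ) (c : ℝ), (∀ y, HasDerivAt ρ (-(β y * ρ y + c * κ y)) y) ∧ ρ 0 = ρ 1 ∧
      ∀ y ∈ Set.Icc (0 : ℝ) 1, 0 < ρ y := by
  set b : ℝ → ℝ := fun y => ∫ x in (0 : ℝ)..y, β x
  have hb : ∀ y, HasDerivAt b (β y) y := fun y => (hβ.integral_hasStrictDerivAt 0 y).hasDerivAt
  have hq : Continuous fun y => κ y * Real.exp (b y) :=
    hκ.mul (continuous_iff_continuousAt.2 fun y => (hb y).continuousAt).rexp
  set I : ℝ → ℝ := fun y => ∫ x in (0 : ℝ)..y, κ x * Real.exp (b x)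
  have hI : ∀ y, HasDerivAt I (κ y * Real.exp (b y)) y := fun y =>
    (hq.integral_hasStrictDerivAt 0 y).hasDerivAt
  have hmono : StrictMono I := strictMono_of_deriv_pos fun y => by
    rw [(hI y).deriv]
    exact mul_pos (hpos y) (Real.exp_pos _)
  have hb0 : b 0 = 0 := intervalIntegral.integral_same
  have hI0 : I 0 = 0 := intervalIntegral.integral_same
  have hexp : ∀ y, Real.exp (-b y) * Real.exp (b y) = 1 := fun y => by
    rw [← Real.exp_add, neg_add_cancel, Real.exp_zero]
  set c : ℝ := 1 - Real.exp (b 1) with hc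
  refine ⟨fun y => Real.exp (-b y) * (I 1 - c * I y), c, fun y => ?_, ?_, fun y hy => ?_⟩
  · refine ((hb y).neg.exp.mul (((hI y).const_mul c).const_sub (I 1))).congr_deriv ?_
    linear_combination (-c * κ y) * hexp y
  · simp only [hb0, hI0, neg_zero, Real.exp_zero, hc]
    linear_combination (-I 1) * hexp 1
  · have hy0 : 0 ≤ I y := hI0 ▸ hmono.monotone hy.1
    have hy1 : I y ≤ I 1 := hmono.monotone hy.2
    have h1 : 0 < I 1 := hI0 ▸ hmono one_pos
    refine mul_pos (Real.exp_pos _) ?_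
    rcases hy0.eq_or_lt with h | h
    · rwa [← h, mul_zero, sub_zero]
    · linarith [mul_pos (Real.exp_pos (b 1)) h, sub_mul 1 (Real.exp (b 1)) (I y)]

/-- A positive `1`-periodic weight `ρ` on `[0, 1]` for which the linearization at `u` of
`u ↦ ∫ ρ √(r² + u²) + d ∫ ρ' curvAngle r u + c ∫ u` vanishes. Testing the equation for the slope
against `ρ` isolates the first variation of the speed. -/
structure IsAdjointWeight (d r c : ℝ) (u ρ : ℝ → ℝ) : Prop where
  differentiable : Differentiable ℝ ρ
  eq_endpoints : ρ 0 = ρ 1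
  pos : ∀ y ∈ Set.Icc (0 : ℝ) 1, 0 < ρ y
  adjoint : ∀ y, ρ y * (u y / eikonal r (u y)) + d * deriv ρ y * (r ^ 2 / eikonal r (u y) ^ 2) = -c

theorem continuous_div_eikonal {r : ℝ} (hr : 0 < r) : Continuous fun t => t / eikonal r t :=
  continuous_id.div (continuous_eikonal r) fun t => (eikonal_pos hr t).ne'

theorem exists_isAdjointWeight {d r : ℝ} (hd : 0 < d) (hr : 0 < r) {u : ℝ → ℝ}
    (hu : Continuous u) : ∃ c ρ, IsAdjointWeight d r c u ρ := by
  have hE : ∀ y, 0 < eikonal r (u y) := fun y => eikonal_pos hr (u y)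
  have hκ : Continuous fun y => eikonal r (u y) ^ 2 / (d * r ^ 2) :=
    (((continuous_eikonal r).comp hu).pow 2).div_const _
  obtain ⟨ρ, c, hρ, h01, hpos⟩ := exists_positive_periodic_linear
    (hκ.mul ((continuous_div_eikonal hr).comp hu)) hκ
    (fun y => div_pos (pow_pos (hE y) 2) (by positivity))
  refine ⟨c, ρ, fun y => (hρ y).differentiableAt, h01, hpos, fun y => ?_⟩
  rw [(hρ y).deriv]
  have hEy := hE y
  simp only [Pi.mul_apply, Function.comp_apply]
  field

theorem arcsin_sub_mul_sub_nonneg (x y : ℝ) : 0 ≤ (Real.arcsin x - Real.arcsin y) * (x - y) :=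
  (le_total x y).elim
    (fun h => mul_nonneg_of_nonpos_of_nonpos (sub_nonpos.2 (Real.monotone_arcsin h))
      (sub_nonpos.2 h))
    fun h => mul_nonneg (sub_nonneg.2 (Real.monotone_arcsin h)) (sub_nonneg.2 h)

theorem arcsin_sub_mul_sub_pos {x y : ℝ} (hx : |x| < 1) (hxy : x ≠ y) :
    0 < (Real.arcsin x - Real.arcsin y) * (x - y) := by
  refine (arcsin_sub_mul_sub_nonneg x y).lt_of_ne'
    (mul_ne_zero (sub_ne_zero.2 fun h => hxy ?_) (sub_ne_zero.2 hxy))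
  have hx' := abs_lt.1 hx
  rw [(Real.arcsin_eq_iff_eq_sin ⟨Real.neg_pi_div_two_lt_arcsin.2 hx'.1,
    Real.arcsin_lt_pi_div_two.2 hx'.2⟩).1 h.symm, Real.sin_arcsin hx'.1.le hx'.2.le]

theorem integral_comp_mul_deriv_eq_zero {ρ g : ℝ → ℝ} {a b : ℝ} (hρ : Differentiable ℝ ρ)
    (hρ' : Continuous (deriv ρ)) (hab : ρ a = ρ b) (hg : ContinuousOn g (ρ '' Set.uIcc a b)) :
    ∫ y in a..b, g (ρ y) * deriv ρ y = 0 := by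
  refine (intervalIntegral.integral_comp_mul_deriv'' hρ.continuous.continuousOn
    (fun y _ => (hρ y).hasDerivAt.hasDerivWithinAt) hρ'.continuousOn hg).trans ?_
  rw [hab, intervalIntegral.integral_same]

namespace IsAdjointWeight

variable {d r c : ℝ} {u ρ : ℝ → ℝ}

theorem deriv_eq (h : IsAdjointWeight d r c u ρ) (hd : 0 < d) (hr : 0 < r) (y : ℝ) :
    deriv ρ y
      = -(eikonal r (u y) ^ 2 / (d * r ^ 2) * (ρ y * (u y / eikonal r (u y)) + c)) := by
  have hE := eikonal_pos hr (u y)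
  have hadj := h.adjoint y
  field_simp at hadj ⊢
  linarith

theorem continuous_deriv (h : IsAdjointWeight d r c u ρ) (hd : 0 < d) (hr : 0 < r)
    (hu : Continuous u) : Continuous (deriv ρ) := by
  rw [funext (h.deriv_eq hd hr)]
  exact ((((continuous_eikonal r).comp hu).pow 2).div_const _ |>.mul
    ((h.differentiable.continuous.mul ((continuous_div_eikonal hr).comp hu)).add_const c)).neg

theorem arcsin_sub_curvAngle_mul_deriv (h : IsAdjointWeight d r c u ρ) (hd : 0 < d) (hr : 0 < r)
    {y : ℝ} (hy : y ∈ Set.Icc (0 : ℝ) 1) :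
    (r * Real.arcsin (-c / ρ y) - curvAngle r (u y)) * deriv ρ y
      = r * (eikonal r (u y) ^ 2 / (d * r ^ 2) * ρ y)
        * ((Real.arcsin (u y / eikonal r (u y)) - Real.arcsin (-c / ρ y))
          * (u y / eikonal r (u y) - -c / ρ y)) := by
  have hc : c = -(ρ y * (-c / ρ y)) := by
    rw [mul_div_cancel₀ _ (h.pos y hy).ne', neg_neg]
  rw [h.deriv_eq hd hr, curvAngle_eq_arcsin hr]
  nth_rewrite 2 [hc]
  ring

theorem exists_div_eikonal_ne (h : IsAdjointWeight d r c u ρ) (hd : 0 < d) (hr : 0 < r)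
    (hnc : ∃ y ∈ Set.Icc (0 : ℝ) 1, u y ≠ u 0) :
    ∃ y ∈ Set.Icc (0 : ℝ) 1, u y / eikonal r (u y) ≠ -c / ρ y := by
  by_contra! heq
  have hderiv : ∀ y ∈ Set.Icc (0 : ℝ) 1, deriv ρ y = 0 := fun y hy => by
    rw [h.deriv_eq hd hr, heq y hy, mul_div_cancel₀ _ (h.pos y hy).ne', neg_add_cancel, mul_zero,
      neg_zero]
  have hconst := constant_of_has_deriv_right_zero h.differentiable.continuous.continuousOn
    fun y hy => (hderiv y (Set.Ico_subset_Icc_self hy) ▸ (h.differentiable y).hasDerivAt)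
      |>.hasDerivWithinAt
  obtain ⟨y, hy, hne⟩ := hnc
  refine hne ((strictMono_curvAngle hr).injective ?_)
  rw [curvAngle_eq_arcsin hr, curvAngle_eq_arcsin hr, heq y hy,
    heq 0 ⟨le_rfl, zero_le_one⟩, hconst y hy]

theorem integral_deriv_mul_curvAngle_neg (h : IsAdjointWeight d r c u ρ) (hd : 0 < d)
    (hr : 0 < r) (hu : Continuous u) (hnc : ∃ y ∈ Set.Icc (0 : ℝ) 1, u y ≠ u 0) :
    ∫ y in (0 : ℝ)..1, deriv ρ y * curvAngle r (u y) < 0 := by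
  -- Subtracting `r arcsin (-c / ρ) ρ'`, whose integral vanishes, makes the integrand signed.
  have hρ' := h.continuous_deriv hd hr hu
  have hA : Continuous fun y => curvAngle r (u y) := (continuous_curvAngle r).comp hu
  have hcoef : ∀ y ∈ Set.Icc (0 : ℝ) 1, 0 < r * (eikonal r (u y) ^ 2 / (d * r ^ 2) * ρ y) :=
    fun y hy => by
      have hE := eikonal_pos hr (u y)
      have hρ := h.pos y hy
      positivity
  have hg : ContinuousOn (fun x => r * Real.arcsin (-c / x)) (ρ '' Set.Icc 0 1) := by
    refine continuousOn_const.mul (Real.continuous_arcsin.comp_continuousOn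
      (continuousOn_const.div continuousOn_id ?_))
    rintro _ ⟨y, hy, rfl⟩
    exact (h.pos y hy).ne'
  have hgρ : ContinuousOn (fun y => r * Real.arcsin (-c / ρ y)) (Set.Icc 0 1) :=
    hg.comp h.differentiable.continuous.continuousOn (Set.mapsTo_image _ _)
  obtain ⟨z, hz, hne⟩ := h.exists_div_eikonal_ne hd hr hnc
  have hpos : 0 < ∫ y in (0 : ℝ)..1,
      (r * Real.arcsin (-c / ρ y) - curvAngle r (u y)) * deriv ρ y :=
    intervalIntegral.integral_pos one_pos ((hgρ.sub hA.continuousOn).mul hρ'.continuousOn)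
      (fun y hy => by
        rw [h.arcsin_sub_curvAngle_mul_deriv hd hr ⟨hy.1.le, hy.2⟩]
        exact mul_nonneg (hcoef y ⟨hy.1.le, hy.2⟩).le (arcsin_sub_mul_sub_nonneg _ _))
      ⟨z, hz, by
        rw [h.arcsin_sub_curvAngle_mul_deriv hd hr hz]
        exact mul_pos (hcoef z hz) (arcsin_sub_mul_sub_pos (abs_div_eikonal_lt_one hr _) hne)⟩
  have hexact : ∫ y in (0 : ℝ)..1, r * Real.arcsin (-c / ρ y) * deriv ρ y = 0 :=
    integral_comp_mul_deriv_eq_zero (g := fun x => r * Real.arcsin (-c / x)) h.differentiable hρ'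
      h.eq_endpoints (by rwa [Set.uIcc_of_le zero_le_one])
  simp only [sub_mul] at hpos
  rw [intervalIntegral.integral_sub, hexact, zero_sub] at hpos
  · simpa only [mul_comm] using neg_pos.1 hpos
  · exact (ContinuousOn.mul hgρ hρ'.continuousOn).intervalIntegrable_of_Icc zero_le_one
  · exact (hA.mul hρ').intervalIntegrable _ _

end IsAdjointWeight

theorem abs_integral_zero_one_le {g : ℝ → ℝ} {K : ℝ} (h : ∀ y ∈ Set.Icc (0 : ℝ) 1, |g y| ≤ K) :
    |∫ y in (0 : ℝ)..1, g y| ≤ K := by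
  have hbound := intervalIntegral.norm_integral_le_of_norm_le_const (a := (0 : ℝ)) (b := 1) (f := g)
    fun y hy => h y (by rw [Set.uIoc_of_le zero_le_one] at hy; exact ⟨hy.1.le, hy.2⟩)
  simpa using hbound

/-- The integrand of the functional that is linearized in `IsAdjointWeight`. -/
noncomputable def adjointIntegrand (d r c : ℝ) (ρ : ℝ → ℝ) (y t : ℝ) : ℝ :=
  ρ y * eikonal r t + d * deriv ρ y * curvAngle r t + c * t

namespace IsAdjointWeight

variable {f u u' ρ : ℝ → ℝ} {d d' r μ c H H' : ℝ}

theorem continuous_adjointIntegrand (hρ : IsAdjointWeight d r c u ρ) (hd : 0 < d) (hr : 0 < r)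
    (hu : Continuous u) (hu' : Continuous u') :
    Continuous fun y => adjointIntegrand d r c ρ y (u' y) := by
  have h1 := hρ.differentiable.continuous
  have h2 := hρ.continuous_deriv hd hr hu
  have h3 := (continuous_eikonal r).comp hu'
  have h4 := (continuous_curvAngle r).comp hu'
  exact ((h1.mul h3).add ((h2.const_mul d).mul h4)).add (hu'.const_mul c)

theorem abs_adjointIntegrand_sub_le (hρ : IsAdjointWeight d r c u ρ) (hd : 0 < d) (hr : 0 < r)
    {N y : ℝ} (hN : |ρ y| ≤ N) (hN' : |deriv ρ y| ≤ N) (t : ℝ) :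
    |adjointIntegrand d r c ρ y t - adjointIntegrand d r c ρ y (u y)|
      ≤ N * (1 + 2 * d) / r * (t - u y) ^ 2 := by
  have hN0 : 0 ≤ N := (abs_nonneg _).trans hN
  have hderiv : ∀ t, HasDerivAt (adjointIntegrand d r c ρ y)
      (ρ y * (t / eikonal r t) + d * deriv ρ y * (r ^ 2 / eikonal r t ^ 2) + c) t := fun t =>
    ((((hasDerivAt_eikonal hr t).const_mul _).add
      ((hasDerivAt_curvAngle hr t).const_mul _)).add ((hasDerivAt_id t).const_mul c)).congr_deriv
      (by rw [mul_one])
  have hlip : ∀ s t, |(ρ y * (s / eikonal r s) + d * deriv ρ y * (r ^ 2 / eikonal r s ^ 2) + c)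
      - (ρ y * (t / eikonal r t) + d * deriv ρ y * (r ^ 2 / eikonal r t ^ 2) + c)|
      ≤ N * (1 + 2 * d) / r * |s - t| := fun s t => by
    calc _ = |ρ y * (s / eikonal r s - t / eikonal r t)
          + d * deriv ρ y * (r ^ 2 / eikonal r s ^ 2 - r ^ 2 / eikonal r t ^ 2)| := by
          congr 1; ring
      _ ≤ |ρ y| * |s / eikonal r s - t / eikonal r t|
          + d * |deriv ρ y| * |r ^ 2 / eikonal r s ^ 2 - r ^ 2 / eikonal r t ^ 2| := by
          refine (abs_add_le _ _).trans_eq ?_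
          rw [abs_mul, abs_mul, abs_mul, abs_of_pos hd]
      _ ≤ N * (1 / r * |s - t|) + d * N * (2 / r * |s - t|) := by
          gcongr
          exacts [abs_div_eikonal_sub_le hr s t, abs_curvature_sub_le hr s t]
      _ = N * (1 + 2 * d) / r * |s - t| := by ring
  have h := abs_sub_sub_deriv_mul_le (by positivity) hderiv hlip t (u y)
  rwa [hρ.adjoint y, neg_add_cancel, zero_mul, sub_zero] at h

theorem integral_mul_residual (hρ : IsAdjointWeight d r c u ρ) (hd : 0 < d) (hr : 0 < r)
    (hu : Continuous u) (hf : Continuous f) (hd' : d' ≠ 0) (h' : IsSlope f d' r μ H' u') :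
    ∫ y in (0 : ℝ)..1, ρ y * (eikonal r (u' y) + f y - H')
      = -(d' * ∫ y in (0 : ℝ)..1, deriv ρ y * curvAngle r (u' y)) := by
  have hres : Continuous fun y => (eikonal r (u' y) + f y - H') / d' :=
    ((((continuous_eikonal r).comp (h'.continuous hr)).add hf).sub continuous_const).div_const d'
  have hparts := intervalIntegral.integral_mul_deriv_eq_deriv_mul (a := 0) (b := 1)
    (fun y _ => (hρ.differentiable y).hasDerivAt) (fun y _ => h'.hasDerivAt_curvAngle y)
    ((hρ.continuous_deriv hd hr hu).intervalIntegrable _ _) (hres.intervalIntegrable _ _)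
  have hbdry : u' 1 = u' 0 := by simpa using h'.periodic 0
  rw [hbdry, ← hρ.eq_endpoints, sub_self, zero_sub] at hparts
  rw [← mul_neg, ← hparts, ← intervalIntegral.integral_const_mul]
  congr 1 with y
  field

theorem integral_adjointIntegrand (hρ : IsAdjointWeight d r c u ρ) (hd : 0 < d) (hr : 0 < r)
    (hu : Continuous u) (hf : Continuous f) (hd' : d' ≠ 0) (h' : IsSlope f d' r μ H' u') :
    ∫ y in (0 : ℝ)..1, adjointIntegrand d r c ρ y (u' y)
      = H' * (∫ y in (0 : ℝ)..1, ρ y) - (∫ y in (0 : ℝ)..1, ρ y * f y) + c * μ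
        - (d' - d) * ∫ y in (0 : ℝ)..1, deriv ρ y * curvAngle r (u' y) := by
  have hρc := hρ.differentiable.continuous
  have hρ' := hρ.continuous_deriv hd hr hu
  have hu' := h'.continuous hr
  have hE : Continuous fun y => eikonal r (u' y) := (continuous_eikonal r).comp hu'
  have hA : Continuous fun y => curvAngle r (u' y) := (continuous_curvAngle r).comp hu'
  have hsplit : (fun y => adjointIntegrand d r c ρ y (u' y)) = fun y =>
      ρ y * (eikonal r (u' y) + f y - H') + d * (deriv ρ y * curvAngle r (u' y)) + c * u' y
        - ρ y * f y + H' * ρ y := funext fun y => by rw [adjointIntegrand]; ring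
  have hint : ∀ {g : ℝ → ℝ}, Continuous g → IntervalIntegrable g MeasureTheory.volume 0 1 :=
    fun hg => hg.intervalIntegrable _ _
  rw [hsplit, intervalIntegral.integral_add (hint (by fun_prop)) (hint (by fun_prop)),
    intervalIntegral.integral_sub (hint (by fun_prop)) (hint (by fun_prop)),
    intervalIntegral.integral_add (hint (by fun_prop)) (hint (by fun_prop)),
    intervalIntegral.integral_add (hint (by fun_prop)) (hint (by fun_prop)),
    hρ.integral_mul_residual hd hr hu hf hd' h', intervalIntegral.integral_const_mul,
    intervalIntegral.integral_const_mul, intervalIntegral.integral_const_mul, h'.mean]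
  ring

theorem abs_integral_adjointIntegrand_sub_le (hρ : IsAdjointWeight d r c u ρ) (hd : 0 < d)
    (hr : 0 < r) (hu : Continuous u) (hu' : Continuous u') {N B : ℝ}
    (hN : ∀ y ∈ Set.Icc (0 : ℝ) 1, |ρ y| ≤ N) (hN' : ∀ y ∈ Set.Icc (0 : ℝ) 1, |deriv ρ y| ≤ N)
    (hB : ∀ y, |u' y - u y| ≤ B) :
    |(∫ y in (0 : ℝ)..1, adjointIntegrand d r c ρ y (u' y))
        - ∫ y in (0 : ℝ)..1, adjointIntegrand d r c ρ y (u y)|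
      ≤ N * (1 + 2 * d) / r * B ^ 2 := by
  have hN0 : 0 ≤ N := (abs_nonneg _).trans (hN 0 ⟨le_rfl, zero_le_one⟩)
  rw [← intervalIntegral.integral_sub
    ((hρ.continuous_adjointIntegrand hd hr hu hu').intervalIntegrable _ _)
    ((hρ.continuous_adjointIntegrand hd hr hu hu).intervalIntegrable _ _)]
  refine abs_integral_zero_one_le fun y hy =>
    (hρ.abs_adjointIntegrand_sub_le hd hr (hN y hy) (hN' y hy) _).trans ?_
  rw [← sq_abs (u' y - u y)]
  gcongr
  exact hB y

theorem abs_integral_deriv_mul_curvAngle_sub_le (hρ : IsAdjointWeight d r c u ρ) (hd : 0 < d)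
    (hr : 0 < r) (hu : Continuous u) (hu' : Continuous u') {N B : ℝ}
    (hN : ∀ y ∈ Set.Icc (0 : ℝ) 1, |deriv ρ y| ≤ N) (hB : ∀ y, |u' y - u y| ≤ B) :
    |(∫ y in (0 : ℝ)..1, deriv ρ y * curvAngle r (u' y))
        - ∫ y in (0 : ℝ)..1, deriv ρ y * curvAngle r (u y)| ≤ N * B := by
  have hN0 : 0 ≤ N := (abs_nonneg _).trans (hN 0 ⟨le_rfl, zero_le_one⟩)
  have hint : ∀ {w : ℝ → ℝ}, Continuous w → IntervalIntegrable
      (fun y => deriv ρ y * curvAngle r (w y)) MeasureTheory.volume 0 1 := fun hw =>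
    ((hρ.continuous_deriv hd hr hu).mul ((continuous_curvAngle r).comp hw)).intervalIntegrable _ _
  rw [← intervalIntegral.integral_sub (hint hu') (hint hu)]
  refine abs_integral_zero_one_le fun y hy => ?_
  rw [← mul_sub, abs_mul]
  gcongr
  exacts [hN y hy, (abs_curvAngle_sub_le hr _ _).trans (hB y)]

theorem abs_speed_variation_le (hρ : IsAdjointWeight d r c u ρ) (hd : 0 < d) (hr : 0 < r)
    (hf : Continuous f) (hd' : 0 < d') (h : IsSlope f d r μ H u) (h' : IsSlope f d' r μ H' u')
    {N C : ℝ} (hN : ∀ y ∈ Set.Icc (0 : ℝ) 1, |ρ y| ≤ N)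
    (hN' : ∀ y ∈ Set.Icc (0 : ℝ) 1, |deriv ρ y| ≤ N) (hC : ∀ y, |u' y - u y| ≤ C * |d' - d|) :
    |(H' - H) * (∫ y in (0 : ℝ)..1, ρ y)
        - (d' - d) * ∫ y in (0 : ℝ)..1, deriv ρ y * curvAngle r (u y)|
      ≤ (N * (1 + 2 * d) / r * C ^ 2 + N * C) * (d' - d) ^ 2 := by
  have hu := h.continuous hr
  have hu' := h'.continuous hr
  have hL := hρ.abs_integral_adjointIntegrand_sub_le hd hr hu hu' hN hN' hC
  have hA := hρ.abs_integral_deriv_mul_curvAngle_sub_le hd hr hu hu' hN' hC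
  rw [hρ.integral_adjointIntegrand hd hr hu hf hd'.ne' h',
    hρ.integral_adjointIntegrand hd hr hu hf hd.ne' h] at hL
  calc _ ≤ N * (1 + 2 * d) / r * (C * |d' - d|) ^ 2 + |d' - d| * (N * (C * |d' - d|)) := by
        refine le_trans ?_ (add_le_add hL (mul_le_mul_of_nonneg_left hA (abs_nonneg (d' - d))))
        rw [← abs_mul]
        refine le_of_eq_of_le ?_ (abs_add_le _ _)
        congr 1
        ring
    _ = (N * (1 + 2 * d) / r * C ^ 2 + N * C) * (d' - d) ^ 2 := by
        rw [← sq_abs (d' - d)]; ring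

end IsAdjointWeight

theorem IsSlope.exists_ne {f u : ℝ → ℝ} {d r μ H : ℝ} (h : IsSlope f d r μ H u) (hd : d ≠ 0)
    (hnc : ¬ ∃ c, ∀ y, f y = c) : ∃ y ∈ Set.Icc (0 : ℝ) 1, u y ≠ u 0 := by
  by_contra! hconst
  have hu : ∀ y, u y = u 0 := fun y => by
    obtain ⟨x, hx, hxy⟩ := h.periodic.exists_mem_Ico₀ one_pos y
    rw [hxy, hconst x (Set.Ico_subset_Icc_self hx)]
  refine hnc ⟨H - eikonal r (u 0), fun y => ?_⟩
  have hderiv := h.hasDerivAt_curvAngle y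
  simp only [hu] at hderiv
  have hzero := hderiv.unique (hasDerivAt_const y _)
  rw [div_eq_zero_iff, or_iff_left hd] at hzero
  linarith

theorem exists_hasDerivAt_speed_neg {f : ℝ → ℝ} {r μ : ℝ} (hr : 0 < r) (hf : Continuous f)
    (hper : Function.Periodic f 1) (hnc : ¬ ∃ c, ∀ y, f y = c) {H : ℝ → ℝ} {u : ℝ → ℝ → ℝ}
    (hu : ∀ d, 0 < d → IsSlope f d r μ (H d) (u d)) {d : ℝ} (hd : 0 < d) :
    ∃ c < 0, HasDerivAt H c d := by
  obtain ⟨M, hM⟩ := exists_abs_le_of_periodic hper one_ne_zero hf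
  have h := hu d hd
  obtain ⟨c, ρ, hρ⟩ := exists_isAdjointWeight hd hr (h.continuous hr)
  obtain ⟨N, hN⟩ := (isCompact_Icc (a := (0 : ℝ)) (b := 1)).exists_bound_of_continuousOn
    hρ.differentiable.continuous.continuousOn
  obtain ⟨N', hN'⟩ := (isCompact_Icc (a := (0 : ℝ)) (b := 1)).exists_bound_of_continuousOn
    (hρ.continuous_deriv hd hr (h.continuous hr)).continuousOn
  obtain ⟨C, -, hC⟩ := h.exists_abs_sub_le hd hr hM
  have hI : 0 < ∫ y in (0 : ℝ)..1, ρ y := intervalIntegral.intervalIntegral_pos_of_pos_on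
    (hρ.differentiable.continuous.intervalIntegrable _ _)
    (fun y hy => hρ.pos y ⟨hy.1.le, hy.2.le⟩) one_pos
  set I := ∫ y in (0 : ℝ)..1, ρ y
  set J := ∫ y in (0 : ℝ)..1, deriv ρ y * curvAngle r (u d y)
  set N₁ := max N N'
  refine ⟨J / I, div_neg_of_neg_of_pos
    (hρ.integral_deriv_mul_curvAngle_neg hd hr (h.continuous hr) (h.exists_ne hd.ne' hnc)) hI,
    hasDerivAt_of_abs_sub_le_sq (K := (N₁ * (1 + 2 * d) / r * C ^ 2 + N₁ * C) / I) ?_⟩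
  filter_upwards [lt_mem_nhds (half_lt_self hd)] with d' hd'
  have hd'0 : 0 < d' := (half_pos hd).trans hd'
  have hvar := hρ.abs_speed_variation_le hd hr hf hd'0 h (hu d' hd'0)
    (fun y hy => (hN y hy).trans (le_max_left _ _))
    (fun y hy => (hN' y hy).trans (le_max_right _ _)) (hC d' _ _ hd'.le (hu d' hd'0))
  rw [div_mul_eq_mul_div, le_div_iff₀ hI]
  refine le_of_eq_of_le ?_ hvar
  rw [← abs_of_pos hI, ← abs_mul, abs_of_pos hI]
  congr 1
  field

/-! ### Large Markstein number -/

theorem abs_le_of_periodic_of_abs_deriv_le {e e' : ℝ → ℝ} {T D : ℝ} (hp : Function.Periodic e T)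
    (hT : 0 < T) (he : ∀ y, HasDerivAt e (e' y) y) (hD : ∀ y, |e' y| ≤ D) (h0 : ∃ y, e y = 0)
    (y : ℝ) : |e y| ≤ D * T := by
  obtain ⟨z, hz⟩ := h0
  obtain ⟨x, hx, hxy⟩ := hp.exists_mem_Ico hT y z
  have hmvt := convex_univ.norm_image_sub_le_of_norm_hasDerivWithin_le
    (fun x _ => (he x).hasDerivWithinAt) (fun x _ => hD x) (Set.mem_univ z) (Set.mem_univ x)
  rw [hz, sub_zero, Real.norm_eq_abs, Real.norm_eq_abs, abs_of_nonneg (sub_nonneg.2 hx.1)] at hmvt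
  rw [hxy]
  exact hmvt.trans (mul_le_mul_of_nonneg_left (sub_le_iff_le_add'.2 hx.2.le)
    ((abs_nonneg _).trans (hD 0)))

namespace IsSlope

variable {f u : ℝ → ℝ} {d r μ H M C : ℝ}

theorem abs_sub_mean_le (h : IsSlope f d r μ H u) (hd : 0 < d) (hr : 0 < r)
    (hM : ∀ y, |f y| ≤ M) (y : ℝ) :
    |u y - μ| ≤ eikonal r (eikonal r μ + 2 * M) ^ 2 / r ^ 2 * (eikonal r μ + 4 * M) / d := by
  have hM0 : 0 ≤ M := (abs_nonneg _).trans (hM 0)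
  have hbound : ∀ y, |(eikonal r (u y) + f y - H) / d| ≤ (eikonal r μ + 4 * M) / d := fun y => by
    rw [abs_div, abs_of_pos hd]
    gcongr
    exact h.abs_residual_le hd hr hM y
  have hangle : |curvAngle r (u y) - curvAngle r μ| ≤ (eikonal r μ + 4 * M) / d := by
    simpa using abs_le_of_periodic_of_abs_deriv_le
      (e := fun y => curvAngle r (u y) - curvAngle r μ)
      (fun y => congrArg (· - curvAngle r μ) (h.curvAngle_periodic y)) one_pos
      (fun y => (h.hasDerivAt_curvAngle y).sub_const _) hbound
      ((h.exists_eq_mean hr).imp fun _ hz => by rw [hz, sub_self]) y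
  have hμ : |μ| ≤ eikonal r μ + 2 * M := by linarith [abs_le_eikonal r μ]
  rw [mul_div_assoc]
  exact (abs_sub_le_curvAngle_sub hr ((abs_le_eikonal r _).trans (h.eikonal_le hd hr hM y))
    hμ).trans (by gcongr)

theorem speed_eq_integral (h : IsSlope f d r μ H u) (hd : d ≠ 0) (hr : 0 < r)
    (hf : Continuous f) :
    H = (∫ y in (0 : ℝ)..1, eikonal r (u y)) + ∫ y in (0 : ℝ)..1, f y := by
  have hE : Continuous fun y => eikonal r (u y) := (continuous_eikonal r).comp (h.continuous hr)
  have hFTC := intervalIntegral.integral_eq_sub_of_hasDerivAt (a := 0) (b := 1)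
    (fun y _ => h.hasDerivAt_curvAngle y)
    (((hE.add hf).sub continuous_const).div_const d |>.intervalIntegrable _ _)
  have hend : u 1 = u 0 := by simpa using h.periodic 0
  rw [hend, sub_self, intervalIntegral.integral_div, div_eq_zero_iff, or_iff_left hd,
    intervalIntegral.integral_sub ((hE.fun_add hf).intervalIntegrable _ _) (by simp)] at hFTC
  simp only [intervalIntegral.integral_const, sub_zero, one_smul] at hFTC
  rw [← intervalIntegral.integral_add (hE.intervalIntegrable _ _) (hf.intervalIntegrable _ _)]
  exact (sub_eq_zero.1 hFTC).symm

theorem abs_speed_sub_mean_le (h : IsSlope f d r μ H u) (hd : d ≠ 0) (hr : 0 < r)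
    (hf : Continuous f) (hC : ∀ y, |u y - μ| ≤ C) :
    |H - (eikonal r μ + ∫ y in (0 : ℝ)..1, f y)| ≤ C := by
  have hE : Continuous fun y => eikonal r (u y) := (continuous_eikonal r).comp (h.continuous hr)
  have hdiff : H - (eikonal r μ + ∫ y in (0 : ℝ)..1, f y)
      = ∫ y in (0 : ℝ)..1, (eikonal r (u y) - eikonal r μ) := by
    rw [intervalIntegral.integral_sub (hE.intervalIntegrable _ _) (by simp),
      h.speed_eq_integral hd hr hf]
    simp
  rw [hdiff]
  exact abs_integral_zero_one_le fun y _ => (abs_eikonal_sub_le r _ _).trans (hC y)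

end IsSlope

theorem eikonal_abs (γ t : ℝ) : eikonal |γ| t = eikonal γ t := by
  rw [eikonal, eikonal, sq_abs]

namespace IsCellSolution

variable {v w : ℝ → ℝ} {d γ μ H : ℝ}

theorem hasDerivAt (h : IsCellSolution v d γ μ H w) (y : ℝ) : HasDerivAt w (deriv w y) y :=
  (h.contDiff.differentiable two_ne_zero y).hasDerivAt

theorem continuous_deriv (h : IsCellSolution v d γ μ H w) : Continuous (deriv w) :=
  h.contDiff.continuous_deriv one_le_two

theorem hasDerivAt_deriv (h : IsCellSolution v d γ μ H w) (y : ℝ) :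
    HasDerivAt (deriv w) (deriv (deriv w) y) y :=
  (((contDiff_succ_iff_deriv (n := 1)).1 h.contDiff).2.2.differentiable one_ne_zero y).hasDerivAt

theorem integral_deriv (h : IsCellSolution v d γ μ H w) : ∫ y in (0 : ℝ)..1, deriv w y = 0 := by
  rw [intervalIntegral.integral_eq_sub_of_hasDerivAt (fun y _ => h.hasDerivAt y)
    (h.continuous_deriv.intervalIntegrable _ _), sub_eq_zero]
  simpa using h.periodic 0

theorem periodic_deriv (h : IsCellSolution v d γ μ H w) :
    Function.Periodic (deriv w) 1 := fun y => by
  rw [← deriv_comp_add_const, funext h.periodic]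

theorem speed_eq (h : IsCellSolution v d γ μ H w) (y : ℝ) :
    H = -(d * γ ^ 2 * deriv (deriv w) y / eikonal γ (μ + deriv w y) ^ 2)
      + eikonal γ (μ + deriv w y) + γ * v y := by
  rw [eikonal_sq]
  exact (h.equation y).symm

theorem isSlope (h : IsCellSolution v d γ μ H w) (hd : d ≠ 0) (hγ : γ ≠ 0) :
    IsSlope (fun y => γ * v y) d |γ| μ H (fun y => μ + deriv w y) := by
  refine ⟨fun y => congrArg (μ + ·) (h.periodic_deriv y), fun y => ?_, ?_⟩
  · refine ((hasDerivAt_curvAngle (abs_pos.2 hγ) _).comp y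
      ((h.hasDerivAt_deriv y).const_add μ)).congr_deriv ?_
    have hpos := (eikonal_pos (abs_pos.2 hγ) (μ + deriv w y)).ne'
    rw [eikonal_abs] at hpos ⊢
    rw [h.speed_eq y, sq_abs]
    field
  · rw [intervalIntegral.integral_add (by simp) (h.continuous_deriv.intervalIntegrable _ _),
      h.integral_deriv]
    simp

theorem eq_of_gamma_zero (h : IsCellSolution v d 0 μ H w) : H = |μ| ∧ ∀ y, deriv w y = 0 := by
  have hnorm : ∀ y, |μ + deriv w y| = H := fun y => by
    simpa [Real.sqrt_sq_eq_abs] using h.equation y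
  obtain ⟨z, hz⟩ := exists_eq_zero_of_integral_eq_zero one_pos h.continuous_deriv h.integral_deriv
  have hH : H = |μ| := by rw [← hnorm z, hz, add_zero]
  have hsq : ∀ y, deriv w y ^ 2 = -(2 * μ) * deriv w y := fun y => by
    have hsq_eq := (sq_eq_sq_iff_abs_eq_abs _ _).2 ((hnorm y).trans hH)
    linarith
  have hint : ∫ y in (0 : ℝ)..1, deriv w y ^ 2 = 0 := by
    simp only [hsq, intervalIntegral.integral_const_mul, h.integral_deriv, mul_zero]
  refine ⟨hH, fun y => ?_⟩
  obtain ⟨x, hx, hxy⟩ := h.periodic_deriv.exists_mem_Ico₀ one_pos y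
  rw [hxy]
  by_contra hne
  exact (intervalIntegral.integral_pos one_pos (h.continuous_deriv.pow 2).continuousOn
    (fun z _ => sq_nonneg _) ⟨x, Set.Ico_subset_Icc_self hx, sq_pos_iff.2 hne⟩).ne' hint

end IsCellSolution

theorem IsSlope.isCellSolution {v u : ℝ → ℝ} {d γ μ H : ℝ}
    (h : IsSlope (fun y => γ * v y) d |γ| μ H u) (hd : d ≠ 0) (hγ : γ ≠ 0) (hv : Continuous v) :
    IsCellSolution v d γ μ H fun y => ∫ x in (0 : ℝ)..y, (u x - μ) := by
  have hr : 0 < |γ| := abs_pos.2 hγ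
  have hu := h.continuous hr
  have hint : ∀ a b, IntervalIntegrable (fun x => u x - μ) MeasureTheory.volume a b := fun a b =>
    (hu.sub continuous_const).intervalIntegrable a b
  have hw : ∀ y, HasDerivAt (fun y => ∫ x in (0 : ℝ)..y, (u x - μ)) (u y - μ) y := fun y =>
    ((hu.sub continuous_const).integral_hasStrictDerivAt 0 y).hasDerivAt
  have hw' : deriv (fun y => ∫ x in (0 : ℝ)..y, (u x - μ)) = fun y => u y - μ :=
    funext fun y => (hw y).deriv
  have hu' := fun y => (h.hasDerivAt hr y).sub_const μ
  have hw'' := funext fun y => (hu' y).deriv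
  refine ⟨?_, periodic_integral_of_integral_eq_zero (fun y => by rw [h.periodic y]) hint ?_ 0,
    fun y => ?_⟩
  · refine (contDiff_succ_iff_deriv (n := 1)).2 ⟨fun y => (hw y).differentiableAt, by simp, ?_⟩
    rw [hw', contDiff_one_iff_deriv, hw'']
    have hE : Continuous fun y => eikonal |γ| (u y) := (continuous_eikonal _).comp hu
    exact ⟨fun y => (hu' y).differentiableAt, by fun_prop⟩
  · rw [intervalIntegral.integral_sub (hu.intervalIntegrable _ _) (by simp), h.mean]
    simp
  · have hE := eikonal_pos hr (u y)
    have hsqrt : √(γ ^ 2 + u y ^ 2) = eikonal |γ| (u y) := (eikonal_abs γ _).symm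
    rw [hw', hw'', add_sub_cancel, hsqrt, ← sq_abs γ, ← eikonal_sq]
    field

/-! ### The inviscid problem -/

theorem isViscositySolution_of_hasDerivAt {F : ℝ → ℝ → ℝ} {w w' : ℝ → ℝ}
    (hw : ∀ y, HasDerivAt w (w' y) y) (h : ∀ y, F y (w' y) = 0) : IsViscositySolution F w := by
  have hc : Continuous w := continuous_iff_continuousAt.2 fun y => (hw y).continuousAt
  have hderiv : ∀ φ : ℝ → ℝ, ContDiff ℝ 1 φ → ∀ y, IsLocalExtr (fun x => w x - φ x) y →
      F y (deriv φ y) = 0 := fun φ hφ y hy => by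
    have hzero := hy.hasDerivAt_eq_zero
      ((hw y).sub (hφ.differentiable one_ne_zero y).hasDerivAt)
    rw [← sub_eq_zero.1 hzero, h]
  exact ⟨⟨hc, fun φ hφ y hy => (hderiv φ hφ y (.inr hy)).le⟩,
    ⟨hc, fun φ hφ y hy => (hderiv φ hφ y (.inl hy)).ge⟩⟩

theorem IsViscositySolution.congr {F F' : ℝ → ℝ → ℝ} {w : ℝ → ℝ} (h : IsViscositySolution F w)
    (hle : ∀ y q, F y q ≤ 0 → F' y q ≤ 0) (hge : ∀ y q, 0 ≤ F y q → 0 ≤ F' y q) :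
    IsViscositySolution F' w :=
  ⟨⟨h.1.1, fun φ hφ y hy => hle _ _ (h.1.2 φ hφ y hy)⟩,
    ⟨h.2.1, fun φ hφ y hy => hge _ _ (h.2.2 φ hφ y hy)⟩⟩

theorem exists_forall_abs_sub_mul_add_le {I μ : ℝ} (hI : 0 < I) (hμ : |μ| ≤ I) (s : ℝ) :
    ∃ k : ℤ, ∀ j : ℤ, |s - k * I| + μ * k ≤ |s - j * I| + μ * j := by
  obtain ⟨hμ₁, hμ₂⟩ := abs_le.1 hμ
  set n := ⌊s / I⌋
  have hn : n * I ≤ s := (le_div_iff₀ hI).1 (Int.floor_le _)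
  have hn' : s ≤ (n + 1) * I := (div_le_iff₀ hI).1 (Int.lt_floor_add_one _).le
  have hbelow : ∀ j : ℤ, j ≤ n → |s - n * I| + μ * n ≤ |s - j * I| + μ * j := fun j hj => by
    have hj' : (j : ℝ) ≤ n := by exact_mod_cast hj
    rw [abs_of_nonneg (sub_nonneg.2 hn)]
    nlinarith [le_abs_self (s - j * I)]
  have habove : ∀ j : ℤ, n < j →
      |s - (n + 1 : ℤ) * I| + μ * (n + 1 : ℤ) ≤ |s - j * I| + μ * j := fun j hj => by
    have hj' : (n + 1 : ℝ) ≤ j := by exact_mod_cast hj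
    push_cast
    rw [abs_of_nonpos (sub_nonpos.2 hn')]
    nlinarith [neg_abs_le (s - j * I)]
  rcases le_total (|s - n * I| + μ * n) (|s - (n + 1 : ℤ) * I| + μ * (n + 1 : ℤ)) with h | h
  · exact ⟨n, fun j => (le_or_gt j n).elim (hbelow j) fun hj => h.trans (habove j hj)⟩
  · exact ⟨n + 1, fun j => (le_or_gt j n).elim (fun hj => h.trans (hbelow j hj)) (habove j)⟩

/-- `ψ` is the pointwise minimum over `k ∈ ℤ` of the cones `s ↦ |s - k I| + μ k`. If `G` is a
primitive of a `1`-periodic `g ≥ 0` with `∫₀¹ g = I`, then `ψ ∘ G` is the Lax–Oleinik formula for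
the solution of `|W'| = g`, `W(x + 1) = W(x) + μ`. -/
structure IsConeEnvelope (I μ : ℝ) (ψ : ℝ → ℝ) : Prop where
  le : ∀ s (k : ℤ), ψ s ≤ |s - k * I| + μ * k
  exists_eq : ∀ s, ∃ k : ℤ, ψ s = |s - k * I| + μ * k

theorem exists_isConeEnvelope {I μ : ℝ} (hI : 0 < I) (hμ : |μ| ≤ I) :
    ∃ ψ, IsConeEnvelope I μ ψ := by
  choose k hk using exists_forall_abs_sub_mul_add_le hI hμ
  exact ⟨fun s => |s - k s * I| + μ * k s, hk, fun s => ⟨k s, rfl⟩⟩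

namespace IsConeEnvelope

variable {I μ : ℝ} {ψ g G : ℝ → ℝ}

theorem le_add_abs_sub (hψ : IsConeEnvelope I μ ψ) (s t : ℝ) : ψ s ≤ ψ t + |s - t| := by
  obtain ⟨k, hk⟩ := hψ.exists_eq t
  linarith [hψ.le s k, abs_sub_le s t (k * I)]

theorem continuous (hψ : IsConeEnvelope I μ ψ) : Continuous ψ :=
  (LipschitzWith.of_le_add fun s t => hψ.le_add_abs_sub s t).continuous

theorem apply_add (hψ : IsConeEnvelope I μ ψ) (s : ℝ) : ψ (s + I) = ψ s + μ := by
  obtain ⟨k, hk⟩ := hψ.exists_eq s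
  obtain ⟨j, hj⟩ := hψ.exists_eq (s + I)
  have hupper := hψ.le (s + I) (k + 1)
  have hlower := hψ.le s (j - 1)
  push_cast at hupper hlower
  rw [show s + I - (k + 1) * I = s - k * I by ring] at hupper
  rw [show s - (j - 1) * I = s + I - j * I by ring] at hlower
  linarith

theorem isViscositySubsolution (hψ : IsConeEnvelope I μ ψ) (hG : ∀ y, HasDerivAt G (g y) y)
    (hg : ∀ y, 0 ≤ g y) :
    IsViscositySubsolution (fun y q => |μ + q| - g y) fun y => ψ (G y) - μ * y := by
  have hmono : Monotone G := monotone_of_hasDerivAt_nonneg hG hg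
  have hGc : Continuous G := continuous_iff_continuousAt.2 fun y => (hG y).continuousAt
  refine ⟨(hψ.continuous.comp hGc).sub (continuous_const_mul μ), fun φ hφ y hmax => ?_⟩
  have hφ' : HasDerivAt (fun z => φ z + μ * z) (deriv φ y + μ * 1) y :=
    (hφ.differentiable one_ne_zero y).hasDerivAt.add ((hasDerivAt_id y).const_mul μ)
  have hright : 0 ≤ deriv φ y + μ * 1 + g y := by
    refine nonneg_of_hasDerivWithinAt_Ioi (hφ'.add (hG y)).hasDerivWithinAt ?_
    filter_upwards [hmax.filter_mono nhdsWithin_le_nhds, self_mem_nhdsWithin] with z hz hyz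
    have hle := hψ.le_add_abs_sub (G y) (G z)
    rw [abs_sub_comm, abs_of_nonneg (sub_nonneg.2 (hmono (Set.mem_Ioi.1 hyz).le))] at hle
    simp only [Pi.add_apply] at hz ⊢
    linarith
  have hleft : deriv φ y + μ * 1 - g y ≤ 0 := by
    refine nonpos_of_hasDerivWithinAt_Iio (hφ'.sub (hG y)).hasDerivWithinAt ?_
    filter_upwards [hmax.filter_mono nhdsWithin_le_nhds, self_mem_nhdsWithin] with z hz hzy
    have hle := hψ.le_add_abs_sub (G y) (G z)
    rw [abs_of_nonneg (sub_nonneg.2 (hmono (Set.mem_Iio.1 hzy).le))] at hle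
    simp only [Pi.sub_apply] at hz ⊢
    linarith
  exact sub_nonpos.2 (abs_le.2 ⟨by linarith, by linarith⟩)

theorem isViscositySupersolution (hψ : IsConeEnvelope I μ ψ) (hG : ∀ y, HasDerivAt G (g y) y)
    (hg : ∀ y, 0 ≤ g y) (hvertex : ∀ y (k : ℤ), G y = k * I → g y = 0) :
    IsViscositySupersolution (fun y q => |μ + q| - g y) fun y => ψ (G y) - μ * y := by
  have hGc : Continuous G := continuous_iff_continuousAt.2 fun y => (hG y).continuousAt
  refine ⟨(hψ.continuous.comp hGc).sub (continuous_const_mul μ), fun φ hφ y hmin => ?_⟩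
  obtain ⟨k, hk⟩ := hψ.exists_eq (G y)
  by_cases hy : G y = k * I
  · simp [hvertex y k hy]
  have hcone : IsLocalMin (fun z => |G z - k * I| - (φ z + μ * z)) y := by
    filter_upwards [hmin] with z hz
    linarith [hψ.le (G z) k]
  have hφ' : HasDerivAt (fun z => φ z + μ * z) (deriv φ y + μ * 1) y :=
    (hφ.differentiable one_ne_zero y).hasDerivAt.add ((hasDerivAt_id y).const_mul μ)
  have hG' : HasDerivAt (fun z => |G z - k * I|) (SignType.sign (G y - k * I) * g y) y :=
    HasDerivAt.comp (h₂ := abs) y (hasDerivAt_abs (sub_ne_zero.2 hy)) ((hG y).sub_const _)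
  have hzero := hcone.hasDerivAt_eq_zero (hG'.sub hφ')
  have hslope : μ + deriv φ y = SignType.sign (G y - k * I) * g y := by linarith
  refine sub_nonneg.2 (le_of_eq ?_)
  rw [hslope, abs_mul, abs_of_nonneg (hg y)]
  rcases lt_or_gt_of_ne (sub_ne_zero.2 hy) with h | h <;> simp [h]

end IsConeEnvelope

theorem eq_zero_of_integral_eq_zero {g : ℝ → ℝ} (hg : Continuous g) (hg0 : ∀ y, 0 ≤ g y)
    {x y : ℝ} (h : ∫ z in x..y, g z = 0) (hx : g x = 0) : g y = 0 := by
  by_contra hne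
  have hpos : 0 < g y := (hg0 y).lt_of_ne' hne
  rcases lt_trichotomy x y with hxy | rfl | hxy
  · exact (intervalIntegral.integral_pos hxy hg.continuousOn (fun z _ => hg0 z)
      ⟨y, ⟨hxy.le, le_rfl⟩, hpos⟩).ne' h
  · exact hne hx
  · rw [intervalIntegral.integral_symm, neg_eq_zero] at h
    exact (intervalIntegral.integral_pos hxy hg.continuousOn (fun z _ => hg0 z)
      ⟨y, ⟨le_rfl, hxy.le⟩, hpos⟩).ne' h

theorem exists_periodic_viscositySolution {g : ℝ → ℝ} {y₀ μ : ℝ} (hg : Continuous g)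
    (hper : Function.Periodic g 1) (hg0 : ∀ y, 0 ≤ g y) (hy₀ : g y₀ = 0)
    (hμ : |μ| < ∫ y in (0 : ℝ)..1, g y) :
    ∃ w, Function.Periodic w 1 ∧ IsViscositySolution (fun y q => |μ + q| - g y) w := by
  set I := ∫ y in (0 : ℝ)..1, g y
  set G : ℝ → ℝ := fun y => ∫ z in y₀..y, g z
  have hG : ∀ y, HasDerivAt G (g y) y := fun y => (hg.integral_hasStrictDerivAt y₀ y).hasDerivAt
  have hint : ∀ a b, IntervalIntegrable g MeasureTheory.volume a b := hg.intervalIntegrable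
  have hshift : ∀ y (k : ℤ), ∫ z in y..y + k, g z = k * I := fun y k => by
    have hsum := hper.intervalIntegral_add_zsmul_eq k y hint
    rw [hper.intervalIntegral_add_eq y 0, zero_add] at hsum
    simpa using hsum
  have hG1 : ∀ y, G (y + 1) = G y + I := fun y => by
    have hperiod := hshift y 1
    rw [Int.cast_one, one_mul] at hperiod
    rw [← hperiod]
    exact (intervalIntegral.integral_add_adjacent_intervals (hint _ _) (hint _ _)).symm
  have hvertex : ∀ y (k : ℤ), G y = k * I → g y = 0 := fun y k hk => by
    refine eq_zero_of_integral_eq_zero hg hg0 (x := y₀ + k) ?_ ?_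
    · rw [← intervalIntegral.integral_interval_sub_left (hint y₀ y) (hint y₀ (y₀ + k)), hshift]
      exact sub_eq_zero.2 hk
    · rw [← hy₀]
      simpa using hper.int_mul k y₀
  obtain ⟨ψ, hψ⟩ := exists_isConeEnvelope ((abs_nonneg μ).trans_lt hμ) hμ.le
  refine ⟨fun y => ψ (G y) - μ * y, fun y => ?_, hψ.isViscositySubsolution hG hg0,
    hψ.isViscositySupersolution hG hg0 hvertex⟩
  simp only [hG1, hψ.apply_add]
  ring

/-- The nonnegative solution `t = √(a² - γ²)` of `eikonal γ t = a`, for `|γ| ≤ a`; it turns the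
inviscid cell problem into `|μ + w'| = inviscidSlope γ (H - γ v)`. -/
noncomputable def inviscidSlope (γ a : ℝ) : ℝ := √(a ^ 2 - γ ^ 2)

theorem inviscidSlope_nonneg (γ a : ℝ) : 0 ≤ inviscidSlope γ a := Real.sqrt_nonneg _

theorem continuous_inviscidSlope (γ : ℝ) : Continuous (inviscidSlope γ) := by
  unfold inviscidSlope; fun_prop

theorem inviscidSlope_abs (γ : ℝ) : inviscidSlope γ |γ| = 0 := by
  simp [inviscidSlope]

theorem eikonal_le_iff {γ a t : ℝ} (ha : 0 ≤ a) (hγ : |γ| ≤ a) :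
    eikonal γ t ≤ a ↔ |t| ≤ inviscidSlope γ a := by
  rw [eikonal, inviscidSlope, Real.sqrt_le_left ha, Real.le_sqrt (abs_nonneg t)
    (sub_nonneg.2 (sq_le_sq.2 (hγ.trans (le_abs_self a)))), sq_abs, le_sub_iff_add_le']

theorem le_eikonal_iff {γ a t : ℝ} (ha : 0 ≤ a) :
    a ≤ eikonal γ t ↔ inviscidSlope γ a ≤ |t| := by
  rw [eikonal, inviscidSlope, Real.le_sqrt ha (by positivity), Real.sqrt_le_left (abs_nonneg t),
    sq_abs, sub_le_iff_le_add']

theorem isInviscidCellSolution_of_abs_slope {v w : ℝ → ℝ} {γ μ H : ℝ}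
    (hH : ∀ y, |γ| ≤ H - γ * v y) (hper : Function.Periodic w 1)
    (hw : IsViscositySolution (fun y q => |μ + q| - inviscidSlope γ (H - γ * v y)) w) :
    IsInviscidCellSolution v γ μ H w := by
  have h0 : ∀ y, 0 ≤ H - γ * v y := fun y => (abs_nonneg γ).trans (hH y)
  refine ⟨hper, hw.congr (fun y q h => ?_) fun y q h => ?_⟩
  · have hle := (eikonal_le_iff (h0 y) (hH y)).2 (sub_nonpos.1 h)
    rw [eikonal] at hle
    linarith
  · have hle := (le_eikonal_iff (h0 y)).2 (sub_nonneg.1 h)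
    rw [eikonal] at hle
    linarith

theorem exists_eq_integral_inviscidSlope {f : ℝ → ℝ} (hf : Continuous f) {y₀ γ μ : ℝ}
    (hy₀ : ∀ y, f y ≤ f y₀) (hμ : ∫ y in (0 : ℝ)..1, inviscidSlope γ (|γ| + f y₀ - f y) ≤ |μ|) :
    ∃ H, |γ| + f y₀ ≤ H ∧ ∫ y in (0 : ℝ)..1, inviscidSlope γ (H - f y) = |μ| := by
  have hslope : ∀ H, Continuous fun y => inviscidSlope γ (H - f y) := fun H =>
    (continuous_inviscidSlope γ).comp (continuous_const.sub hf)
  have hcont : Continuous fun H => ∫ y in (0 : ℝ)..1, inviscidSlope γ (H - f y) :=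
    intervalIntegral.continuous_parametric_intervalIntegral_of_continuous'
      (f := fun H y => inviscidSlope γ (H - f y))
      ((continuous_inviscidSlope γ).comp (continuous_fst.sub (hf.comp continuous_snd))) 0 1
  have hle : |γ| + f y₀ ≤ eikonal γ μ + f y₀ := by gcongr; exact abs_left_le_eikonal γ μ
  have hupper : |μ| ≤ ∫ y in (0 : ℝ)..1, inviscidSlope γ (eikonal γ μ + f y₀ - f y) := by
    have hmono := intervalIntegral.integral_mono_on (μ := MeasureTheory.volume) zero_le_one
      (f := fun _ => |μ|) intervalIntegrable_const
      ((hslope (eikonal γ μ + f y₀)).intervalIntegrable 0 1) fun y _ =>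
        (eikonal_le_iff (by linarith [hy₀ y, eikonal_nonneg γ μ])
          (by linarith [hy₀ y, abs_left_le_eikonal γ μ])).1 (by linarith [hy₀ y])
    simpa using hmono
  obtain ⟨H, hH, hHμ⟩ := intermediate_value_Icc hle hcont.continuousOn ⟨hμ, hupper⟩
  exact ⟨H, hH.1, hHμ⟩

theorem exists_periodic_viscositySolution_of_integral_eq {g : ℝ → ℝ} {μ : ℝ} (hg : Continuous g)
    (hper : Function.Periodic g 1) (hg0 : ∀ y, 0 ≤ g y) (hμ : ∫ y in (0 : ℝ)..1, g y = |μ|) :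
    ∃ w, Function.Periodic w 1 ∧ IsViscositySolution (fun y q => |μ + q| - g y) w := by
  obtain ⟨σ, hσ, hσμ⟩ : ∃ σ : ℝ, |σ| = 1 ∧ σ * |μ| = μ := by
    rcases le_total 0 μ with h | h
    · exact ⟨1, abs_one, by rw [abs_of_nonneg h, one_mul]⟩
    · exact ⟨-1, by simp, by rw [abs_of_nonpos h, neg_mul_neg, one_mul]⟩
  have hw' : Continuous fun y => σ * g y - μ := (hg.const_mul σ).sub continuous_const
  refine ⟨fun y => ∫ x in (0 : ℝ)..y, (σ * g x - μ), periodic_integral_of_integral_eq_zero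
      (fun y => by rw [hper y]) hw'.intervalIntegrable ?_ 0,
    isViscositySolution_of_hasDerivAt
      (fun y => (hw'.integral_hasStrictDerivAt 0 y).hasDerivAt) fun y => ?_⟩
  · rw [intervalIntegral.integral_sub ((hg.const_mul σ).intervalIntegrable _ _) (by simp),
      intervalIntegral.integral_const_mul, hμ, hσμ]
    simp
  · rw [add_sub_cancel, abs_mul, hσ, one_mul, abs_of_nonneg (hg0 y), sub_self]

theorem exists_isInviscidCellSolution {v : ℝ → ℝ} (hv : Continuous v)
    (hper : Function.Periodic v 1) (γ μ : ℝ) : ∃ H w, IsInviscidCellSolution v γ μ H w := by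
  have hf : Continuous fun y => γ * v y := hv.const_mul γ
  obtain ⟨y₀, hy₀⟩ := exists_forall_ge_of_periodic (u := fun y => γ * v y)
    (hper.comp (γ * ·)) one_ne_zero hf
  have hslope : ∀ H, Continuous fun y => inviscidSlope γ (H - γ * v y) := fun H =>
    (continuous_inviscidSlope γ).comp (continuous_const.sub hf)
  have hslope_per : ∀ H, Function.Periodic (fun y => inviscidSlope γ (H - γ * v y)) 1 :=
    fun H => hper.comp fun t => inviscidSlope γ (H - γ * t)
  rcases lt_or_ge |μ| (∫ y in (0 : ℝ)..1, inviscidSlope γ (|γ| + γ * v y₀ - γ * v y))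
    with hμ | hμ
  · obtain ⟨w, hw, hsol⟩ := exists_periodic_viscositySolution (hslope _) (hslope_per _)
      (fun y => inviscidSlope_nonneg _ _) (by rw [add_sub_cancel_right, inviscidSlope_abs]) hμ
    exact ⟨_, w, isInviscidCellSolution_of_abs_slope (fun y => by linarith [hy₀ y]) hw hsol⟩
  · obtain ⟨H, hH, hHμ⟩ := exists_eq_integral_inviscidSlope hf hy₀ hμ
    obtain ⟨w, hw, hsol⟩ := exists_periodic_viscositySolution_of_integral_eq (hslope H)
      (hslope_per H) (fun y => inviscidSlope_nonneg _ _) hHμ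
    exact ⟨H, w, isInviscidCellSolution_of_abs_slope (fun y => by linarith [hy₀ y]) hw hsol⟩

/-! ### Doubling of variables -/

theorem uniformContinuous_of_periodic {u : ℝ → ℝ} {T : ℝ} (hT : 0 < T)
    (hu : Function.Periodic u T) (hc : Continuous u) : UniformContinuous u := by
  have : Fact (0 < T) := ⟨hT⟩
  have hlift : UniformContinuous (hu.lift : AddCircle T → ℝ) :=
    CompactSpace.uniformContinuous_of_continuous (continuous_coinduced_dom.2 hc)
  exact hlift.comp (uniformContinuous_addMonoidHom_of_continuous
    (f := QuotientAddGroup.mk' (AddSubgroup.zmultiples T)) (AddCircle.continuous_mk' T))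

theorem exists_pos_abs_sub_le_of_mul_sq_le {f : ℝ → ℝ} (hf : UniformContinuous f) {η : ℝ}
    (hη : 0 < η) (M : ℝ) : ∃ c > 0, ∀ x y, c * (x - y) ^ 2 ≤ M → |f x - f y| ≤ η := by
  obtain ⟨δ, hδ, hfδ⟩ := Metric.uniformContinuous_iff.1 hf η hη
  refine ⟨(|M| + 1) / δ ^ 2, by positivity, fun x y hxy => (hfδ ?_).le⟩
  by_contra! hle
  have hsq : δ ^ 2 ≤ (x - y) ^ 2 := by
    rw [← sq_abs (x - y)]
    exact pow_le_pow_left₀ hδ.le hle 2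
  have hlt : |M| + 1 ≤ (|M| + 1) / δ ^ 2 * (x - y) ^ 2 := by
    rw [div_mul_eq_mul_div, le_div_iff₀ (by positivity)]
    gcongr
  linarith [le_abs_self M]

theorem exists_forall_doubling_le {w₁ w₂ : ℝ → ℝ} {c : ℝ} (hc : 0 ≤ c) (hc₁ : Continuous w₁)
    (hc₂ : Continuous w₂) (hp₁ : Function.Periodic w₁ 1) (hp₂ : Function.Periodic w₂ 1) :
    ∃ x y, ∀ x' y', w₁ x' - w₂ y' - c * (x' - y') ^ 2 ≤ w₁ x - w₂ y - c * (x - y) ^ 2 := by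
  -- Integer shifts bring any pair into `[0, 1] × [-1, 2]` without increasing its distance.
  obtain ⟨⟨x, y⟩, -, hmax⟩ := ((isCompact_Icc (a := (0 : ℝ)) (b := 1)).prod
    (isCompact_Icc (a := (-1 : ℝ)) (b := 2))).exists_isMaxOn
    (f := fun z => w₁ z.1 - w₂ z.2 - c * (z.1 - z.2) ^ 2) ⟨(0, 0), by norm_num⟩ (by fun_prop)
  refine ⟨x, y, fun x' y' => ?_⟩
  set n := ⌊x'⌋
  set k := round (y' - x')
  have hround := abs_le.1 (abs_sub_round (y' - x'))
  have hn := Int.floor_le x'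
  have hn' := Int.lt_floor_add_one x'
  have hbox := hmax (a := (x' - n, y' - (n + k : ℤ)))
    ⟨⟨by linarith, by linarith⟩, by push_cast; linarith, by push_cast; linarith⟩
  have hw₁ : w₁ (x' - n) = w₁ x' := by simpa using hp₁.sub_int_mul_eq (x := x') n
  have hw₂ : w₂ (y' - (n + k : ℤ)) = w₂ y' := by simpa using hp₂.sub_int_mul_eq (x := y') (n + k)
  have hsq : (x' - n - (y' - (n + k : ℤ))) ^ 2 ≤ (x' - y') ^ 2 := by
    have hle : |y' - x' - k| ≤ |y' - x'| := by simpa using round_le (y' - x') 0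
    calc (x' - n - (y' - (n + k : ℤ))) ^ 2 = (y' - x' - k) ^ 2 := by push_cast; ring
      _ ≤ (y' - x') ^ 2 := sq_le_sq.2 hle
      _ = (x' - y') ^ 2 := by ring
  simp only [Set.mem_ofPred_eq, hw₁, hw₂] at hbox
  linarith [mul_le_mul_of_nonneg_left hsq hc]

theorem speed_le_add_of_doubling {F f w₁ w₂ : ℝ → ℝ} {c M η H₁ H₂ : ℝ} (hc : 0 ≤ c)
    (hc₁ : Continuous w₁) (hc₂ : Continuous w₂) (hp₁ : Function.Periodic w₁ 1)
    (hp₂ : Function.Periodic w₂ 1)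
    (hM : (∀ x y, w₁ x - w₁ y ≤ M) ∨ ∀ x y, w₂ x - w₂ y ≤ M)
    (hf : ∀ x y, c * (x - y) ^ 2 ≤ M → |f x - f y| ≤ η)
    (hsub : ∀ x y, IsLocalMax (fun z => w₁ z - c * (z - y) ^ 2) x →
      F (2 * c * (x - y)) + f x ≤ H₁)
    (hsup : ∀ x y, IsLocalMin (fun z => w₂ z + c * (z - x) ^ 2) y →
      H₂ ≤ F (2 * c * (x - y)) + f y) : H₂ ≤ H₁ + η := by
  obtain ⟨x, y, hmax⟩ := exists_forall_doubling_le hc hc₁ hc₂ hp₁ hp₂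
  have hpenalty : c * (x - y) ^ 2 ≤ M := by
    rcases hM with hM | hM
    · linarith [hmax y y, hM x y]
    · linarith [hmax x x, hM x y]
  have hx := hsub x y (Eventually.of_forall fun z => by linarith [hmax z y])
  have hy := hsup x y (Eventually.of_forall fun z => by linarith [hmax x z])
  linarith [neg_abs_le (f x - f y), hf x y hpenalty]

theorem second_deriv_nonpos_of_isLocalMax {e e' : ℝ → ℝ} {c x : ℝ}
    (he : ∀ y, HasDerivAt e (e' y) y) (he' : HasDerivAt e' c x) (hmax : IsLocalMax e x) :
    c ≤ 0 := by
  have hderiv : deriv e = e' := funext fun y => (he y).deriv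
  by_contra! hc
  have hmin : IsLocalMin e x := isLocalMin_of_deriv_deriv_pos (by rwa [hderiv, he'.deriv])
    hmax.deriv_eq_zero (he x).continuousAt
  have hconst : e =ᶠ[𝓝 x] fun _ => e x := by
    filter_upwards [hmin, hmax] with z h h' using le_antisymm h' h
  refine hc.ne' ?_
  rw [← he'.deriv, ← hderiv, hconst.deriv.deriv_eq]
  simp

theorem deriv_eq_of_isLocalMax_sub_sq {w w' w'' : ℝ → ℝ} (hw : ∀ y, HasDerivAt w (w' y) y)
    (hw' : ∀ y, HasDerivAt w' (w'' y) y) {a c x : ℝ}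
    (hmax : IsLocalMax (fun z => w z - c * (z - a) ^ 2) x) :
    w' x = 2 * c * (x - a) ∧ w'' x ≤ 2 * c := by
  have he : ∀ y, HasDerivAt (fun z => w z - c * (z - a) ^ 2) (w' y - 2 * c * (y - a)) y :=
    fun y => ((hw y).fun_sub ((((hasDerivAt_id y).sub_const a).pow 2).const_mul c)).congr_deriv
      (by simp; ring)
  have he' : HasDerivAt (fun y => w' y - 2 * c * (y - a)) (w'' x - 2 * c) x :=
    ((hw' x).fun_sub (((hasDerivAt_id x).sub_const a).const_mul (2 * c))).congr_deriv (by simp)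
  exact ⟨sub_eq_zero.1 (hmax.hasDerivAt_eq_zero (he x)),
    sub_nonpos.1 (second_deriv_nonpos_of_isLocalMax he he' hmax)⟩

theorem deriv_eq_of_isLocalMin_add_sq {w w' w'' : ℝ → ℝ} (hw : ∀ y, HasDerivAt w (w' y) y)
    (hw' : ∀ y, HasDerivAt w' (w'' y) y) {a c y : ℝ}
    (hmin : IsLocalMin (fun z => w z + c * (z - a) ^ 2) y) :
    w' y = 2 * c * (a - y) ∧ -(2 * c) ≤ w'' y := by
  obtain ⟨h, h'⟩ := deriv_eq_of_isLocalMax_sub_sq (fun y => (hw y).fun_neg)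
    (fun y => (hw' y).fun_neg) (a := a) (c := c) (x := y)
    (by simpa only [neg_add, sub_eq_add_neg] using hmin.neg)
  exact ⟨by linarith, by linarith⟩

namespace IsCellSolution

variable {v w : ℝ → ℝ} {d γ μ H a c x : ℝ}

theorem exists_eikonal_add_eq (h : IsCellSolution v d γ μ H w) (hd : 0 ≤ d) (y : ℝ) :
    ∃ θ, 0 ≤ θ ∧ θ ≤ d ∧
      eikonal γ (μ + deriv w y) + γ * v y = H + θ * deriv (deriv w) y := by
  have hle : γ ^ 2 / eikonal γ (μ + deriv w y) ^ 2 ≤ 1 := by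
    refine div_le_one_of_le₀ ?_ (sq_nonneg _)
    rw [eikonal_sq]
    exact le_add_of_nonneg_right (sq_nonneg _)
  refine ⟨d * (γ ^ 2 / eikonal γ (μ + deriv w y) ^ 2), by positivity,
    mul_le_of_le_one_right hd hle, ?_⟩
  rw [h.speed_eq y]
  ring

theorem eikonal_add_le_of_isLocalMax (h : IsCellSolution v d γ μ H w) (hd : 0 ≤ d) (hc : 0 ≤ c)
    (hmax : IsLocalMax (fun z => w z - c * (z - a) ^ 2) x) :
    eikonal γ (μ + 2 * c * (x - a)) + γ * v x ≤ H + 2 * c * d := by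
  obtain ⟨hw', hw''⟩ := deriv_eq_of_isLocalMax_sub_sq h.hasDerivAt h.hasDerivAt_deriv hmax
  obtain ⟨θ, hθ, hθd, heq⟩ := h.exists_eikonal_add_eq hd x
  rw [← hw', heq]
  nlinarith

theorem le_eikonal_add_of_isLocalMin (h : IsCellSolution v d γ μ H w) (hd : 0 ≤ d) (hc : 0 ≤ c)
    (hmin : IsLocalMin (fun z => w z + c * (z - a) ^ 2) x) :
    H - 2 * c * d ≤ eikonal γ (μ + 2 * c * (a - x)) + γ * v x := by
  obtain ⟨hw', hw''⟩ := deriv_eq_of_isLocalMin_add_sq h.hasDerivAt h.hasDerivAt_deriv hmin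
  obtain ⟨θ, hθ, hθd, heq⟩ := h.exists_eikonal_add_eq hd x
  rw [← hw', heq]
  nlinarith

end IsCellSolution

namespace IsInviscidCellSolution

variable {v w w' : ℝ → ℝ} {d γ μ H H' a c x : ℝ}

theorem eikonal_add_le_of_isLocalMax (h : IsInviscidCellSolution v γ μ H w)
    (hmax : IsLocalMax (fun z => w z - c * (z - a) ^ 2) x) :
    eikonal γ (μ + 2 * c * (x - a)) + γ * v x ≤ H := by
  have hφ : HasDerivAt (fun z => c * (z - a) ^ 2) (2 * c * (x - a)) x :=
    ((((hasDerivAt_id x).sub_const a).pow 2).const_mul c).congr_deriv (by simp; ring)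
  have hle := h.2.1.2 (fun z => c * (z - a) ^ 2) (by fun_prop) x hmax
  rw [hφ.deriv] at hle
  exact sub_nonpos.1 hle

theorem le_eikonal_add_of_isLocalMin (h : IsInviscidCellSolution v γ μ H w)
    (hmin : IsLocalMin (fun z => w z + c * (z - a) ^ 2) x) :
    H ≤ eikonal γ (μ + 2 * c * (a - x)) + γ * v x := by
  have hφ : HasDerivAt (fun z => -(c * (z - a) ^ 2)) (2 * c * (a - x)) x :=
    ((((hasDerivAt_id x).sub_const a).pow 2).const_mul c).fun_neg.congr_deriv (by simp; ring)
  have hle := h.2.2.2 (fun z => -(c * (z - a) ^ 2)) (by fun_prop) x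
    (by simpa only [sub_neg_eq_add] using hmin)
  rw [hφ.deriv] at hle
  exact sub_nonneg.1 hle

theorem exists_oscillation_le (h : IsInviscidCellSolution v γ μ H w) :
    ∃ M, ∀ x y, w x - w y ≤ M := by
  obtain ⟨C, hC⟩ := exists_abs_le_of_periodic h.1 one_ne_zero h.2.1.1
  exact ⟨C + C, fun x y => by linarith [(abs_le.1 (hC x)).2, (abs_le.1 (hC y)).1]⟩

theorem speed_le (h : IsInviscidCellSolution v γ μ H w) (h' : IsInviscidCellSolution v γ μ H' w')
    (hv : UniformContinuous fun y => γ * v y) : H' ≤ H := by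
  refine le_of_forall_pos_le_add fun η hη => ?_
  obtain ⟨M, hM⟩ := h.exists_oscillation_le
  obtain ⟨c, hc, hosc⟩ := exists_pos_abs_sub_le_of_mul_sq_le hv hη M
  exact speed_le_add_of_doubling (F := fun q => eikonal γ (μ + q)) hc.le h.2.1.1 h'.2.1.1 h.1 h'.1
    (.inl hM) hosc (fun x y => h.eikonal_add_le_of_isLocalMax)
    fun x y => h'.le_eikonal_add_of_isLocalMin

theorem abs_speed_sub_le (h : IsInviscidCellSolution v γ μ H w) (h' : IsCellSolution v d γ μ H' w')
    (hd : 0 ≤ d) {M η : ℝ} (hc : 0 ≤ c) (hM : ∀ x y, w x - w y ≤ M)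
    (hosc : ∀ x y, c * (x - y) ^ 2 ≤ M → |γ * v x - γ * v y| ≤ η) :
    |H' - H| ≤ 2 * c * d + η := by
  have hw' := h'.contDiff.continuous
  have hlower := speed_le_add_of_doubling (F := fun q => eikonal γ (μ + q)) hc hw' h.2.1.1
    h'.periodic h.1 (.inr hM) hosc (fun x y => h'.eikonal_add_le_of_isLocalMax hd hc)
    fun x y => h.le_eikonal_add_of_isLocalMin
  have hupper := speed_le_add_of_doubling (F := fun q => eikonal γ (μ + q)) hc h.2.1.1 hw' h.1
    h'.periodic (.inl hM) hosc (fun x y => h.eikonal_add_le_of_isLocalMax)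
    fun x y => h'.le_eikonal_add_of_isLocalMin hd hc
  exact abs_le.2 ⟨by linarith, by linarith⟩

end IsInviscidCellSolution

/-! ### The effective speed -/

theorem isCellSolution_zero (v : ℝ → ℝ) (d μ : ℝ) :
    IsCellSolution v d 0 μ |μ| fun _ => 0 := by
  refine ⟨contDiff_const, fun _ => rfl, fun y => ?_⟩
  simp [Real.sqrt_sq_eq_abs]

section

variable {v : ℝ → ℝ} {d γ μ : ℝ} (hv : Continuous v) (hper : Function.Periodic v 1)

include hv hper

theorem exists_abs_const_mul_le (γ : ℝ) : ∃ M, ∀ y, |γ * v y| ≤ M :=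
  exists_abs_le_of_periodic (hper.comp (γ * ·)) one_ne_zero (hv.const_mul γ)

theorem IsCellSolution.unique {w w' : ℝ → ℝ} {H H' : ℝ} (hd : 0 < d)
    (h : IsCellSolution v d γ μ H w) (h' : IsCellSolution v d γ μ H' w') :
    H = H' ∧ deriv w = deriv w' := by
  rcases eq_or_ne γ 0 with rfl | hγ
  · obtain ⟨hH, hw⟩ := h.eq_of_gamma_zero
    obtain ⟨hH', hw'⟩ := h'.eq_of_gamma_zero
    exact ⟨hH.trans hH'.symm, funext fun y => (hw y).trans (hw' y).symm⟩
  · obtain ⟨M, hM⟩ := exists_abs_const_mul_le hv hper γ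
    obtain ⟨hH, hu⟩ := (h.isSlope hd.ne' hγ).unique (h'.isSlope hd.ne' hγ) hd (abs_pos.2 hγ) hM
    exact ⟨hH, funext fun y => add_left_cancel (congrFun hu y)⟩

theorem IsCellSolution.eq_of_apply_zero {w w' : ℝ → ℝ} {H H' : ℝ} (hd : 0 < d)
    (h : IsCellSolution v d γ μ H w) (h' : IsCellSolution v d γ μ H' w') (h0 : w 0 = w' 0) :
    w = w' :=
  eq_of_fderiv_eq (h.contDiff.differentiable two_ne_zero) (h'.contDiff.differentiable two_ne_zero)
    (fun x => ContinuousLinearMap.ext_ring (congrFun (h.unique hv hper hd h').2 x)) 0 h0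

theorem exists_isCellSolution (hd : 0 < d) (γ μ : ℝ) :
    ∃ H w, IsCellSolution v d γ μ H w ∧ w 0 = 0 := by
  rcases eq_or_ne γ 0 with rfl | hγ
  · exact ⟨|μ|, _, isCellSolution_zero v d μ, rfl⟩
  · obtain ⟨H, u, hu⟩ := exists_isSlope hd (abs_pos.2 hγ) (hv.const_mul γ)
      (hper.comp (γ * ·)) μ
    exact ⟨H, _, hu.isCellSolution hd.ne' hγ hv, intervalIntegral.integral_same⟩

theorem isCellSolution_cellCorrector (hd : 0 < d) (γ μ : ℝ) :
    IsCellSolution v d γ μ (effectiveSpeed v d γ μ) (cellCorrector v d γ μ) ∧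
      cellCorrector v d γ μ 0 = 0 := by
  obtain ⟨H, w, hw, hw0⟩ := exists_isCellSolution hv hper hd γ μ
  obtain ⟨w', hw'⟩ := Classical.epsilon_spec
    (p := fun H : ℝ => ∃ w : ℝ → ℝ, IsCellSolution v d γ μ H w) ⟨H, w, hw⟩
  have hH : H = effectiveSpeed v d γ μ := (hw.unique hv hper hd hw').1
  exact Classical.epsilon_spec (p := fun w : ℝ → ℝ =>
    IsCellSolution v d γ μ (effectiveSpeed v d γ μ) w ∧ w 0 = 0) ⟨w, hH ▸ hw, hw0⟩

theorem existsUnique_cell_speed (hd : 0 < d) (γ μ : ℝ) :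
    ∃! H, ∃ w, IsCellSolution v d γ μ H w :=
  have h := (isCellSolution_cellCorrector hv hper hd γ μ).1
  ⟨_, ⟨_, h⟩, fun _ ⟨_, hw⟩ => (hw.unique hv hper hd h).1⟩

theorem existsUnique_cell_corrector (hd : 0 < d) (γ μ : ℝ) :
    ∃! w, IsCellSolution v d γ μ (effectiveSpeed v d γ μ) w ∧ w 0 = 0 :=
  have h := isCellSolution_cellCorrector hv hper hd γ μ
  ⟨_, h, fun _ hw => hw.1.eq_of_apply_zero hv hper hd h.1 (hw.2.trans h.2.symm)⟩

theorem effectiveSpeed_zero (hd : 0 < d) (μ : ℝ) : effectiveSpeed v d 0 μ = |μ| :=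
  (isCellSolution_cellCorrector hv hper hd 0 μ).1.eq_of_gamma_zero.1

theorem cellCorrector_zero (hd : 0 < d) (μ : ℝ) : cellCorrector v d 0 μ = fun _ => 0 :=
  have h := isCellSolution_cellCorrector hv hper hd 0 μ
  h.1.eq_of_apply_zero hv hper hd (isCellSolution_zero v d μ) h.2

theorem exists_forall_abs_deriv_cellCorrector_le (hγ : γ ≠ 0) (μ : ℝ) :
    ∃ C, ∀ d, 0 < d → ∀ y, |deriv (cellCorrector v d γ μ) y| ≤ C / d := by
  obtain ⟨M, hM⟩ := exists_abs_const_mul_le hv hper γ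
  refine ⟨eikonal |γ| (eikonal |γ| μ + 2 * M) ^ 2 / |γ| ^ 2 * (eikonal |γ| μ + 4 * M),
    fun d hd y => ?_⟩
  have h := (isCellSolution_cellCorrector hv hper hd γ μ).1.isSlope hd.ne' hγ
  simpa only [add_sub_cancel_left] using h.abs_sub_mean_le hd (abs_pos.2 hγ) hM y

theorem tendsto_effectiveSpeed_atTop (γ μ : ℝ) :
    Tendsto (fun d => effectiveSpeed v d γ μ) atTop
      (𝓝 (√(γ ^ 2 + μ ^ 2) + γ * ∫ y in (0 : ℝ)..1, v y)) := by
  rcases eq_or_ne γ 0 with rfl | hγ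
  · refine tendsto_const_nhds.congr' ?_
    filter_upwards [eventually_gt_atTop 0] with d hd
    rw [effectiveSpeed_zero hv hper hd]
    simp [Real.sqrt_sq_eq_abs]
  · obtain ⟨C, hC⟩ := exists_forall_abs_deriv_cellCorrector_le hv hper hγ μ
    refine tendsto_iff_dist_tendsto_zero.2 (squeeze_zero' (Eventually.of_forall
      fun _ => dist_nonneg) (g := fun d => C / d) ?_ (tendsto_const_nhds.div_atTop tendsto_id))
    filter_upwards [eventually_gt_atTop 0] with d hd
    have h := (isCellSolution_cellCorrector hv hper hd γ μ).1.isSlope hd.ne' hγ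
    have hle := h.abs_speed_sub_mean_le hd.ne' (abs_pos.2 hγ) (hv.const_mul γ)
      fun y => by simpa only [add_sub_cancel_left] using hC d hd y
    rwa [eikonal_abs, intervalIntegral.integral_const_mul] at hle

theorem tendstoUniformly_cellCorrector (γ μ : ℝ) :
    TendstoUniformly (fun d => cellCorrector v d γ μ) (fun _ => 0) atTop := by
  rw [Metric.tendstoUniformly_iff]
  intro ε hε
  rcases eq_or_ne γ 0 with rfl | hγ
  · filter_upwards [eventually_gt_atTop 0] with d hd y
    rwa [cellCorrector_zero hv hper hd, dist_self]
  · obtain ⟨C, hC⟩ := exists_forall_abs_deriv_cellCorrector_le hv hper hγ μ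
    have hlim : Tendsto (fun d => C / d) atTop (𝓝 0) := tendsto_const_nhds.div_atTop tendsto_id
    filter_upwards [eventually_gt_atTop 0, hlim.eventually (gt_mem_nhds hε)] with d hd hlt y
    obtain ⟨h, h0⟩ := isCellSolution_cellCorrector hv hper hd γ μ
    have hle := abs_le_of_periodic_of_abs_deriv_le h.periodic one_pos h.hasDerivAt (hC d hd)
      ⟨0, h0⟩ y
    rw [mul_one] at hle
    rw [dist_comm, Real.dist_eq, sub_zero]
    exact hle.trans_lt hlt

theorem exists_hasDerivAt_effectiveSpeed_neg (hnc : ¬ ∃ c, ∀ y, v y = c) (hγ : γ ≠ 0) (μ : ℝ)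
    (hd : 0 < d) : ∃ c < 0, HasDerivAt (fun s => effectiveSpeed v s γ μ) c d := by
  refine exists_hasDerivAt_speed_neg (abs_pos.2 hγ) (hv.const_mul γ) (hper.comp (γ * ·)) ?_
    (fun s hs => (isCellSolution_cellCorrector hv hper hs γ μ).1.isSlope hs.ne' hγ) hd
  rintro ⟨c, hc⟩
  exact hnc ⟨c / γ, fun y => by rw [← hc y]; field⟩

theorem strictAntiOn_effectiveSpeed (hnc : ¬ ∃ c, ∀ y, v y = c) (hγ : γ ≠ 0) (μ : ℝ) :
    StrictAntiOn (fun s => effectiveSpeed v s γ μ) (Set.Ioi 0) := by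
  have hderiv := fun d (hd : 0 < d) => exists_hasDerivAt_effectiveSpeed_neg hv hper hnc hγ μ hd
  refine strictAntiOn_of_deriv_neg (convex_Ioi 0) (fun d hd => ?_) fun d hd => ?_
  · obtain ⟨c, -, hc⟩ := hderiv d hd
    exact hc.continuousAt.continuousWithinAt
  · rw [interior_Ioi] at hd
    obtain ⟨c, hc0, hc⟩ := hderiv d hd
    rwa [hc.deriv]

theorem existsUnique_inviscid_speed (γ μ : ℝ) : ∃! H, ∃ w, IsInviscidCellSolution v γ μ H w := by
  have hf := uniformContinuous_of_periodic one_pos (hper.comp (γ * ·)) (hv.const_mul γ)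
  obtain ⟨H, w, h⟩ := exists_isInviscidCellSolution hv hper γ μ
  exact ⟨H, ⟨w, h⟩, fun _ ⟨_, h'⟩ => le_antisymm (h.speed_le h' hf) (h'.speed_le h hf)⟩

theorem tendsto_effectiveSpeed_inviscid (γ μ : ℝ) :
    Tendsto (fun d => effectiveSpeed v d γ μ) (𝓝[>] 0) (𝓝 (inviscidEffectiveSpeed v γ μ)) := by
  obtain ⟨w, hw⟩ : ∃ w, IsInviscidCellSolution v γ μ (inviscidEffectiveSpeed v γ μ) w :=
    Classical.epsilon_spec (p := fun H : ℝ => ∃ w : ℝ → ℝ, IsInviscidCellSolution v γ μ H w)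
      (existsUnique_inviscid_speed hv hper γ μ).exists
  have hf := uniformContinuous_of_periodic one_pos (hper.comp (γ * ·)) (hv.const_mul γ)
  obtain ⟨M, hM⟩ := hw.exists_oscillation_le
  refine Metric.tendsto_nhds.2 fun ε hε => ?_
  obtain ⟨c, hc, hosc⟩ := exists_pos_abs_sub_le_of_mul_sq_le hf (half_pos hε) M
  have hsmall : ∀ᶠ d in 𝓝[>] 0, 2 * c * d < ε / 2 := by
    refine (Continuous.tendsto' (by fun_prop) 0 0 (mul_zero _)).eventually_lt_const ?_
      |>.filter_mono nhdsWithin_le_nhds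
    exact half_pos hε
  filter_upwards [self_mem_nhdsWithin, hsmall] with d hd hdc
  have hle := hw.abs_speed_sub_le (isCellSolution_cellCorrector hv hper hd γ μ).1
    (Set.mem_Ioi.1 hd).le hc.le hM hosc
  rw [Real.dist_eq]
  linarith

end

theorem theorem1p1_general (v : ℝ → ℝ) (hv : Continuous v) (hper : Function.Periodic v 1)
    (hnc : ¬ ∃ c : ℝ, ∀ y : ℝ, v y = c) :
    (∀ d γ μ : ℝ, 0 < d →
      (∃! H : ℝ, ∃ w : ℝ → ℝ, IsCellSolution v d γ μ H w) ∧
      (∃! w : ℝ → ℝ, IsCellSolution v d γ μ (effectiveSpeed v d γ μ) w ∧ w 0 = 0)) ∧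
    (∀ γ μ : ℝ, ∃! H : ℝ, ∃ w : ℝ → ℝ, IsInviscidCellSolution v γ μ H w) ∧
    (∀ d μ : ℝ, 0 < d →
      effectiveSpeed v d 0 μ = |μ| ∧ effectiveSpeed v d 0 (-μ) = |μ|) ∧
    (∀ γ μ : ℝ, γ ≠ 0 →
      (∀ d : ℝ, 0 < d →
        DifferentiableAt ℝ (fun s : ℝ => effectiveSpeed v s γ μ) d ∧
        deriv (fun s : ℝ => effectiveSpeed v s γ μ) d < 0) ∧
      StrictAntiOn (fun s : ℝ => effectiveSpeed v s γ μ) (Set.Ioi 0)) ∧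
    (∀ γ μ : ℝ, Tendsto (fun d : ℝ => effectiveSpeed v d γ μ) (𝓝[>] 0)
      (𝓝 (inviscidEffectiveSpeed v γ μ))) ∧
    (∀ γ μ : ℝ,
      Tendsto (fun d : ℝ => effectiveSpeed v d γ μ) atTop
        (𝓝 (√(γ ^ 2 + μ ^ 2) + γ * ∫ y in (0 : ℝ)..1, v y)) ∧
      TendstoUniformly (fun d : ℝ => cellCorrector v d γ μ) (fun _ : ℝ => 0) atTop) := by
  refine ⟨fun d γ μ hd => ⟨existsUnique_cell_speed hv hper hd γ μ,
      existsUnique_cell_corrector hv hper hd γ μ⟩,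
    existsUnique_inviscid_speed hv hper,
    fun d μ hd => ⟨effectiveSpeed_zero hv hper hd μ, ?_⟩,
    fun γ μ hγ => ⟨fun d hd => ?_, strictAntiOn_effectiveSpeed hv hper hnc hγ μ⟩,
    tendsto_effectiveSpeed_inviscid hv hper,
    fun γ μ => ⟨tendsto_effectiveSpeed_atTop hv hper γ μ,
      tendstoUniformly_cellCorrector hv hper γ μ⟩⟩
  · rw [effectiveSpeed_zero hv hper hd, abs_neg]
  · obtain ⟨c, hc, hderiv⟩ := exists_hasDerivAt_effectiveSpeed_neg hv hper hnc hγ μ hd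
    exact ⟨hderiv.differentiableAt, hderiv.deriv.trans_lt hc⟩

theorem theorem1p1 (v : ℝ → ℝ) (hv : ContDiff ℝ ∞ v) (hper : Function.Periodic v 1)
    (hnc : ¬ ∃ c : ℝ, ∀ y : ℝ, v y = c) :
    -- well-posedness: `H̄_d(p)`, `w` and `H̄_0(p)` exist and are unique
    (∀ d γ μ : ℝ, 0 < d →
      (∃! H : ℝ, ∃ w : ℝ → ℝ, IsCellSolution v d γ μ H w) ∧
      (∃! w : ℝ → ℝ, IsCellSolution v d γ μ (effectiveSpeed v d γ μ) w ∧ w 0 = 0)) ∧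
    (∀ γ μ : ℝ, ∃! H : ℝ, ∃ w : ℝ → ℝ, IsInviscidCellSolution v γ μ H w) ∧
    -- (1)
    (∀ d μ : ℝ, 0 < d →
      effectiveSpeed v d 0 μ = |μ| ∧ effectiveSpeed v d 0 (-μ) = |μ|) ∧
    -- (2)
    (∀ γ μ : ℝ, γ ≠ 0 →
      (∀ d : ℝ, 0 < d →
        DifferentiableAt ℝ (fun s : ℝ => effectiveSpeed v s γ μ) d ∧
        deriv (fun s : ℝ => effectiveSpeed v s γ μ) d < 0) ∧
      StrictAntiOn (fun s : ℝ => effectiveSpeed v s γ μ) (Set.Ioi 0)) ∧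
    -- (3)
    (∀ γ μ : ℝ, Tendsto (fun d : ℝ => effectiveSpeed v d γ μ) (𝓝[>] 0)
      (𝓝 (inviscidEffectiveSpeed v γ μ))) ∧
    -- (4)
    (∀ γ μ : ℝ,
      Tendsto (fun d : ℝ => effectiveSpeed v d γ μ) atTop
        (𝓝 (√(γ ^ 2 + μ ^ 2) + γ * ∫ y in (0 : ℝ)..1, v y)) ∧
      TendstoUniformly (fun d : ℝ => cellCorrector v d γ μ) (fun _ : ℝ => 0) atTop) :=
  theorem1p1_general v hv.continuous hper hnc
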